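/- **Theorem 2.1.** Let $\mathbf{F}_q$ be a finite field with $q$ elements, let $n \ge 0$, and let $\mathcal{X} \subseteq \mathbf{A}^n$ be an affine variety over $\mathbf{F}_q$, that is, a closed reduced subscheme of $\mathbf{A}^n = \operatorname{Spec} \mathbf{F}_q[x_1,\dots,x_n]$, given by a radical ideal of $\mathbf{F}_q[x_1,\dots,x_n]$. Let $\mathcal{X}_1,\dots,\mathcal{X}_r$ be its irreducible components over $\mathbf{F}_q$ (not assumed to be absolutely irreducible, nor to have the same dimension), and for each $i$ let $d_{\mathcal{X}_i}$ be the dimension of $\mathcal{X}_i$ and $\delta_{\mathcal{X}_i}$ its degree. Here the degree of $\mathcal{X}_i$ is the degree of its closure in $\mathbf{P}^n$, namely $d_{\mathcal{X}_i}!$ times the leading coefficient of the Hilbert polynomial of that closure. Then the set $\mathcal{X}(\mathbf{F}_q)$ of $\mathbf{F}_q$-rational points of $\mathcal{X}$ satisfies $$|\mathcal{X}(\mathbf{F}_q)| \le \sum_{i=1}^r \delta_{\mathcal{X}_i}\, q^{d_{\mathcal{X}_i}}.$$ -/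

import Mathlib

open MvPolynomial

noncomputable section

namespace AffinePoints

variable {F : Type*} [Field F] {n : ℕ}

/-- The set `X(F)` of `F`-rational points of the closed subscheme `X` of affine `n`-space over `F`
with defining ideal `I`: the points of `F ^ n` at which every element of `I` vanishes. -/
def rationalPoints (I : Ideal (MvPolynomial (Fin n) F)) : Set (Fin n → F) :=
  zeroLocus F I

/-- The finite set of irreducible components over `F` of the affine variety with defining ideal
`I`, each component being given by its (prime) defining ideal. These are the minimal primes
over `I`, i.e. the maximal irreducible closed subvarieties. -/
def components (I : Ideal (MvPolynomial (Fin n) F)) : Finset (Ideal (MvPolynomial (Fin n) F)) :=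
  (I.finite_minimalPrimes_of_isNoetherianRing).toFinset

/-- The dimension of the affine variety with defining ideal `P`: the Krull dimension of its
coordinate ring, as a natural number (`0` for the empty variety, which is never a component). -/
def dim (P : Ideal (MvPolynomial (Fin n) F)) : ℕ :=
  ((ringKrullDim (MvPolynomial (Fin n) F ⧸ P)).unbotD 0).toNat

/-- The homogenization `x₀ ^ (deg f) * f (x₁ / x₀, …, xₙ / x₀)` of `f`, the new variable being the
one of index `0`. -/
def homogenize (f : MvPolynomial (Fin n) F) : MvPolynomial (Fin (n + 1)) F :=
  ∑ m ∈ f.support, monomial (Finsupp.cons (f.totalDegree - m.degree) m) (coeff m f)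

/-- The homogeneous ideal of the projective closure in projective `n`-space of the affine variety
with defining ideal `P`, generated by the homogenizations of all elements of `P`. -/
def projectiveClosure (P : Ideal (MvPolynomial (Fin n) F)) :
    Ideal (MvPolynomial (Fin (n + 1)) F) :=
  Ideal.span (homogenize '' (P : Set (MvPolynomial (Fin n) F)))

/-- The Hilbert function of a homogeneous ideal `J` of `S`: the dimension over `F` of the graded
piece `(S / J)_t`, which is the image in `S / J` of the space of homogeneous polynomials of
degree `t`. -/
def hilbertFunction {N : ℕ} (J : Ideal (MvPolynomial (Fin N) F)) (t : ℕ) : ℕ :=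
  Module.finrank F ((homogeneousSubmodule (Fin N) F t).map (Ideal.Quotient.mkₐ F J).toLinearMap)

/-- `p` is the Hilbert polynomial of `J`: it agrees with the Hilbert function at all large
integers. -/
def IsHilbertPolynomial {N : ℕ} (J : Ideal (MvPolynomial (Fin N) F)) (p : Polynomial ℚ) : Prop :=
  ∃ t₀ : ℕ, ∀ t : ℕ, t₀ ≤ t → (hilbertFunction J t : ℚ) = p.eval (t : ℚ)

open Classical in
/-- The Hilbert polynomial of `J` (`0` if none exists, which does not happen for a homogeneous
ideal). -/
def hilbertPolynomial {N : ℕ} (J : Ideal (MvPolynomial (Fin N) F)) : Polynomial ℚ :=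
  if h : ∃ p, IsHilbertPolynomial J p then h.choose else 0

/-- The degree of the irreducible affine variety with defining ideal `P`, which is the degree of
its projective closure: `d!` times the leading coefficient of the Hilbert polynomial of the
projective closure, where `d` is the dimension (an irreducible affine variety is open and dense
in its projective closure, so the two have the same dimension). -/
def degree (P : Ideal (MvPolynomial (Fin n) F)) : ℚ :=
  (dim P).factorial * (hilbertPolynomial (projectiveClosure P)).leadingCoeff

/-- Hilbert polynomials are unique, so the choice in `hilbertPolynomial` is immaterial. -/
theorem IsHilbertPolynomial.unique {N : ℕ} {J : Ideal (MvPolynomial (Fin N) F)}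
    {p r : Polynomial ℚ} (hp : IsHilbertPolynomial J p) (hr : IsHilbertPolynomial J r) :
    p = r := by
  obtain ⟨a, ha⟩ := hp
  obtain ⟨b, hb⟩ := hr
  refine Polynomial.eq_of_infinite_eval_eq p r ?_
  refine Set.Infinite.mono (s := (fun t : ℕ => (t : ℚ)) '' Set.Ici (max a b)) ?_ ?_
  · rintro _ ⟨t, ht, rfl⟩
    have ht' : max a b ≤ t := ht
    exact (ha t (le_trans (le_max_left _ _) ht')).symm.trans
      (hb t (le_trans (le_max_right _ _) ht'))
  · exact (Set.Ici_infinite _).image (Nat.cast_injective.injOn)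

/-- On irreducible varieties, `dim` is the Krull dimension of the coordinate ring. -/
theorem coe_dim (P : Ideal (MvPolynomial (Fin n) F)) [P.IsPrime] :
    ((dim P : ℕ) : WithBot ℕ∞) = ringKrullDim (MvPolynomial (Fin n) F ⧸ P) := by
  have h0 : 0 ≤ ringKrullDim (MvPolynomial (Fin n) F ⧸ P) := ringKrullDim_nonneg_of_nontrivial
  have h1 : ringKrullDim (MvPolynomial (Fin n) F ⧸ P) ≤ (n : ℕ) := by
    refine (ringKrullDim_quotient_le P).trans ?_
    rw [MvPolynomial.ringKrullDim_of_isNoetherianRing]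
    simp
  unfold dim
  generalize ringKrullDim (MvPolynomial (Fin n) F ⧸ P) = x at h0 h1
  induction x with
  | bot => simp at h0
  | coe y =>
    have hy : y ≤ (n : ℕ∞) := by exact_mod_cast h1
    have hy' : y ≠ ⊤ := fun h => by simp [h] at hy
    lift y to ℕ using hy'
    simp

end AffinePoints

end

/-! Every rational point lies on some component, so it suffices to treat a prime ideal `P`. Let `R`
be its coordinate ring, `d` the dimension, `q` the order of the field, and `p` the Hilbert
polynomial of the projective closure. The idea is to count the points thickened to order `k`, that
is, to bound the sum over rational points `x` of `dim R / m_x ^ k` from both sides, and to let `k`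
grow.

Above: the ideals `m_x ^ k` are pairwise comaximal, so `R` surjects onto the product of the
quotients. This surjection kills the `k`-th power of the ideal generated by the `X i ^ q - X i`, and
modulo that power every polynomial is congruent to one of degree at most `n q + k q`. So for large
`k` the sum is at most `p (n q + k q)` (`sum_finrank_le_affineHilbert`,
`hilbertFunction_projectiveClosure`).

Below: each term is at least `k ^ d / d!`. A chain of `d + 1` primes ending at `m_x`, with
Artin–Rees, gives growth of order `k ^ d` with some positive constant (`exists_growth_of_ltSeries`).
The dimension also counts standard monomials, which form a lower set; one growing like `k ^ d`
contains all monomials in some `d` variables, and this yields the constant `1 / d!`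
(`exists_finset_of_countLT_growth`).

Comparing coefficients of `k ^ d` gives the bound, once `p` is known to have degree at most `d`; the
same combinatorics shows this, since standard variables are algebraically independent
(`natDegree_hilbertPolynomial_le`). -/

noncomputable section

namespace AffinePoints

/-! ### Counting functions of lower sets of exponents are eventually polynomial -/

/-- The exponent vectors of total degree less than `k`. -/
def exponentsLT (n k : ℕ) : Finset (Fin n →₀ ℕ) :=
  (Finset.range k).biUnion fun t => (Finset.univ : Finset (Fin n)).finsuppAntidiag t

@[simp]
theorem mem_exponentsLT {n k : ℕ} {a : Fin n →₀ ℕ} : a ∈ exponentsLT n k ↔ a.degree < k := by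
  simp [exponentsLT, Finsupp.degree_eq_sum]

/-- A function on the natural numbers which agrees with a rational polynomial eventually. -/
def EventuallyPolynomial (f : ℕ → ℚ) : Prop :=
  ∃ p : Polynomial ℚ, ∀ᶠ t : ℕ in Filter.atTop, f t = p.eval (t : ℚ)

namespace EventuallyPolynomial

theorem add {f g : ℕ → ℚ} (hf : EventuallyPolynomial f) (hg : EventuallyPolynomial g) :
    EventuallyPolynomial fun t => f t + g t := by
  obtain ⟨p, hp⟩ := hf
  obtain ⟨r, hr⟩ := hg
  refine ⟨p + r, ?_⟩
  filter_upwards [hp, hr] with t h1 h2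
  rw [h1, h2, Polynomial.eval_add]

theorem const (c : ℚ) : EventuallyPolynomial fun _ => c :=
  ⟨Polynomial.C c, by simp⟩

theorem sum {ι : Type*} (s : Finset ι) {f : ι → ℕ → ℚ}
    (hf : ∀ i ∈ s, EventuallyPolynomial (f i)) :
    EventuallyPolynomial fun t => ∑ i ∈ s, f i t := by
  classical
  induction s using Finset.induction_on with
  | empty => simpa using const 0
  | insert i s hi ih =>
    simp only [Finset.sum_insert hi]
    exact (hf i (by simp)).add (ih fun j hj => hf j (by simp [hj]))

theorem comp_sub {f : ℕ → ℚ} (hf : EventuallyPolynomial f) (j : ℕ) :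
    EventuallyPolynomial fun t => f (t - j) := by
  obtain ⟨p, hp⟩ := hf
  refine ⟨p.comp (Polynomial.X - Polynomial.C (j : ℚ)), ?_⟩
  filter_upwards [(Filter.tendsto_sub_atTop_nat j).eventually hp, Filter.eventually_ge_atTop j]
    with t h1 h2
  rw [h1]
  simp [Nat.cast_sub h2]

theorem comp_add {f : ℕ → ℚ} (hf : EventuallyPolynomial f) (j : ℕ) :
    EventuallyPolynomial fun t => f (t + j) := by
  obtain ⟨p, hp⟩ := hf
  refine ⟨p.comp (Polynomial.X + Polynomial.C (j : ℚ)), ?_⟩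
  filter_upwards [(Filter.tendsto_add_atTop_nat j).eventually hp] with t h1
  rw [h1]
  simp

theorem congr {f g : ℕ → ℚ} (hf : EventuallyPolynomial f)
    (h : ∀ᶠ t : ℕ in Filter.atTop, g t = f t) : EventuallyPolynomial g := by
  obtain ⟨p, hp⟩ := hf
  refine ⟨p, ?_⟩
  filter_upwards [hp, h] with t h1 h2
  rw [h2, h1]

end EventuallyPolynomial

theorem exists_polynomial_eval_eq_sum_range (p : Polynomial ℚ) :
    ∃ r : Polynomial ℚ, ∀ t : ℕ, r.eval (t : ℚ) = ∑ i ∈ Finset.range t, p.eval (i : ℚ) := by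
  induction p using Polynomial.induction_on' with
  | add p r hp hr =>
    obtain ⟨p', hp'⟩ := hp
    obtain ⟨r', hr'⟩ := hr
    exact ⟨p' + r', fun t => by simp [hp', hr', Finset.sum_add_distrib]⟩
  | monomial m c =>
    -- Faulhaber's formula for sums of `m`-th powers.
    refine ⟨Polynomial.C (c / (m + 1)) *
      (Polynomial.bernoulli m.succ - Polynomial.C (_root_.bernoulli m.succ)), fun t => ?_⟩
    have h := Polynomial.bernoulli_succ_eval t m
    have hm : (m : ℚ) + 1 ≠ 0 := by positivity
    simp only [Polynomial.eval_mul, Polynomial.eval_sub, Polynomial.eval_C, h,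
      Polynomial.eval_monomial, ← Finset.mul_sum]
    field_simp
    ring

theorem EventuallyPolynomial.sum_range {f : ℕ → ℚ} (hf : EventuallyPolynomial f) :
    EventuallyPolynomial fun t => ∑ i ∈ Finset.range t, f i := by
  obtain ⟨p, hp⟩ := hf
  obtain ⟨K, hK⟩ := Filter.eventually_atTop.1 hp
  obtain ⟨r, hr⟩ := exists_polynomial_eval_eq_sum_range p
  -- The constant corrects the finitely many values below `K` where `f` and `p` may differ.
  refine ⟨r + Polynomial.C (∑ i ∈ Finset.range K, (f i - p.eval (i : ℚ))), ?_⟩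
  filter_upwards [Filter.eventually_ge_atTop K] with t ht
  rw [Polynomial.eval_add, hr, Polynomial.eval_C, ← sub_eq_iff_eq_add', ← Finset.sum_sub_distrib,
    ← Finset.sum_range_add_sum_Ico _ ht, add_eq_left]
  refine Finset.sum_eq_zero fun i hi => ?_
  rw [hK i (Finset.mem_Ico.1 hi).1, sub_self]

open Classical in
/-- The number of elements of total degree less than `k` of a set of exponent vectors. -/
def countLT {n : ℕ} (D : Set (Fin n →₀ ℕ)) (k : ℕ) : ℕ :=
  ((exponentsLT n k).filter (· ∈ D)).card

theorem degree_cons {n : ℕ} (j : ℕ) (a : Fin n →₀ ℕ) :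
    (Finsupp.cons j a).degree = j + a.degree := by
  simp [Finsupp.degree_eq_sum, Fin.sum_univ_succ]

theorem countLT_succ {n : ℕ} (D : Set (Fin (n + 1) →₀ ℕ)) (k : ℕ) :
    countLT D k = ∑ j ∈ Finset.range k, countLT {a | Finsupp.cons j a ∈ D} (k - j) := by
  classical
  unfold countLT
  rw [Finset.card_eq_sum_card_fiberwise (f := fun a => a 0) (t := Finset.range k)]
  · refine Finset.sum_congr rfl fun j hj => ?_
    rw [Finset.mem_range] at hj
    refine (Finset.card_bij (fun a _ => Finsupp.cons j a) ?_ ?_ ?_).symm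
    · intro a ha
      simp only [Finset.mem_filter, mem_exponentsLT, Set.mem_ofPred_eq, degree_cons] at ha ⊢
      exact ⟨⟨by omega, ha.2⟩, by simp⟩
    · intro a _ b _ h
      exact (Finsupp.cons_right_injective j) h
    · intro b hb
      simp only [Finset.mem_filter, mem_exponentsLT] at hb
      have hc : Finsupp.cons j b.tail = b := by rw [← hb.2, Finsupp.cons_tail]
      refine ⟨b.tail, ?_, hc⟩
      have := degree_cons j b.tail
      rw [hc] at this
      simp only [Finset.mem_filter, mem_exponentsLT, Set.mem_ofPred_eq, hc]
      exact ⟨by omega, hb.1.2⟩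
  · intro a ha
    simp only [Finset.coe_filter, mem_exponentsLT, Set.mem_ofPred_eq] at ha
    simpa using (Finsupp.le_degree 0 a).trans_lt ha.1

/-- Induction on the number of variables, slicing by the first exponent `j`. The slices are constant
from some `J` on, so the count is a finite sum of shifted counts plus the summation of one stable
count. -/
theorem eventuallyPolynomial_countLT {n : ℕ} {D : Set (Fin n →₀ ℕ)} (hD : IsLowerSet D) :
    EventuallyPolynomial fun k => (countLT D k : ℚ) := by
  induction n with
  | zero =>
    refine (EventuallyPolynomial.const (countLT D 1 : ℚ)).congr ?_
    filter_upwards [Filter.eventually_ge_atTop 1] with k hk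
    unfold countLT
    congr 3
    ext a
    simp [Subsingleton.elim a 0]
    omega
  | succ n ih =>
    have hs : ∀ j, IsLowerSet {a : Fin n →₀ ℕ | Finsupp.cons j a ∈ D} := by
      intro j a b hba ha
      refine hD ?_ ha
      intro i
      refine Fin.cases ?_ (fun i => ?_) i <;> simp [hba _]
    obtain ⟨J, hJ⟩ : ∃ J, ∀ j ≥ J, {a : Fin n →₀ ℕ | Finsupp.cons j a ∈ D} =
        {a | Finsupp.cons J a ∈ D} := by
      -- Dickson's lemma: the complement has finitely many minimal elements. `J` bounds their first
      -- coordinates, so raising the first coordinate beyond `J` never leaves `D`.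
      have hfin : {m | Minimal (· ∈ Dᶜ) m}.Finite :=
        WellQuasiOrderedLE.finite_of_isAntichain (setOfPred_minimal_antichain _)
      obtain ⟨J, hJ⟩ := (hfin.image fun m => m 0).bddAbove
      refine ⟨J, fun j hj => Set.ext fun a => ⟨fun h => hD ?_ h, fun h => ?_⟩⟩
      · intro i
        refine Fin.cases ?_ (fun i => ?_) i <;> simp [hj]
      · by_contra hc
        obtain ⟨m, hm, hmin⟩ := exists_minimal_le_of_wellFoundedLT (· ∈ Dᶜ) _ hc
        refine hmin.1 (hD ?_ h)
        intro i
        refine Fin.cases ?_ (fun i => ?_) i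
        · simpa using hJ ⟨m, hmin, rfl⟩
        · simpa using hm i.succ
    have h1 : EventuallyPolynomial fun k =>
        ∑ j ∈ Finset.range J, (countLT {a : Fin n →₀ ℕ | Finsupp.cons j a ∈ D} (k - j) : ℚ) :=
      EventuallyPolynomial.sum _ fun j _ => (ih (hs j)).comp_sub j
    have h2 := (((ih (hs J)).comp_add 1).sum_range).comp_sub J
    refine (h1.add h2).congr ?_
    filter_upwards [Filter.eventually_ge_atTop J] with k hk
    rw [countLT_succ, Nat.cast_sum, ← Finset.sum_range_add_sum_Ico _ hk]
    congr 1
    rw [Finset.sum_Ico_eq_sum_range, ← Finset.sum_range_reflect]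
    refine Finset.sum_congr rfl fun i hi => ?_
    rw [Finset.mem_range] at hi
    rw [hJ _ (Nat.le_add_right _ _)]
    congr 2
    omega

/-! ### Growth of a lower set and the coordinate orthants it contains -/

/-- A member of `D` with `e + 1` coordinates at least `N` would dominate an excluded vector. So `D`
is covered by boxes with at most `e` long sides, of length `k`, the others having length `N`. -/
theorem countLT_le_of_forall_exists_notMem {n e : ℕ} {D : Set (Fin n →₀ ℕ)} (hD : IsLowerSet D)
    (h : ∀ A : Finset (Fin n), A.card = e + 1 → ∃ a : Fin n →₀ ℕ, a.support ⊆ A ∧ a ∉ D) :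
    ∃ C : ℕ, ∀ k, countLT D k ≤ C * k ^ e := by
  classical
  choose! g hg hgD using h
  let N : ℕ := ∑ A : Finset (Fin n), (g A).degree + 1
  have hN1 : 1 ≤ N := by simp [N]
  have hN : ∀ A : Finset (Fin n), ∀ i, g A i ≤ N := fun A i =>
    (Finsupp.le_degree i _).trans <| (Finset.single_le_sum (f := fun A => (g A).degree)
      (fun _ _ => Nat.zero_le _) (Finset.mem_univ A)).trans (Nat.le_succ _)
  have hcard : ∀ a ∈ D, (Finset.univ.filter fun i => N ≤ a i).card ≤ e := by
    intro a ha
    by_contra! hlt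
    obtain ⟨A, hA, hAe⟩ := Finset.exists_subset_card_eq (Nat.succ_le_of_lt hlt)
    refine hgD A hAe (hD ?_ ha)
    intro i
    by_cases hi : i ∈ A
    · exact (hN A i).trans (Finset.mem_filter.1 (hA hi)).2
    · have : g A i = 0 := by
        by_contra h0
        exact hi (hg A hAe (Finsupp.mem_support_iff.2 h0))
      simp [this]
  -- There are at most `2 ^ n` choices of the long sides, and each box has at most `N ^ n * k ^ e`
  -- points.
  refine ⟨2 ^ n * N ^ n, fun k => ?_⟩
  rcases Nat.eq_zero_or_pos k with rfl | hk
  · simp [countLT, exponentsLT]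
  let box : Finset (Fin n) → Finset (Fin n → ℕ) := fun B =>
    Fintype.piFinset fun i => Finset.range (if i ∈ B then k else N)
  have hbox : ∀ B : Finset (Fin n), B.card ≤ e → (box B).card ≤ N ^ n * k ^ e := by
    intro B hB
    simp only [box, Fintype.card_piFinset, Finset.card_range]
    rw [Finset.prod_ite, Finset.prod_const, Finset.prod_const, mul_comm]
    refine Nat.mul_le_mul (Nat.pow_le_pow_right hN1 ?_) (Nat.pow_le_pow_right hk ?_)
    · exact (Finset.card_le_univ _).trans (by simp)
    · simpa using hB
  calc countLT D k
      ≤ (((Finset.univ : Finset (Fin n)).powerset.filter (·.card ≤ e)).biUnion box).card := by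
        refine Finset.card_le_card_of_injOn (fun a => ⇑a) ?_ fun a _ b _ hab =>
          DFunLike.coe_injective hab
        intro a ha
        simp only [Finset.coe_filter, mem_exponentsLT, Set.mem_ofPred_eq] at ha
        simp only [Finset.coe_biUnion, Set.mem_iUnion, Finset.mem_coe, Finset.mem_filter]
        refine ⟨Finset.univ.filter fun i => N ≤ a i, ⟨by simp, hcard a ha.2⟩, ?_⟩
        simp only [box, Fintype.mem_piFinset, Finset.mem_range, Finset.mem_filter,
          Finset.mem_univ, true_and]
        intro i
        split_ifs with hi
        · exact (Finsupp.le_degree i a).trans_lt ha.1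
        · omega
    _ ≤ _ * (N ^ n * k ^ e) :=
        Finset.card_biUnion_le_card_mul _ _ _ fun B hB => hbox B (Finset.mem_filter.1 hB).2
    _ ≤ 2 ^ n * N ^ n * k ^ e := by
        rw [mul_assoc]
        refine Nat.mul_le_mul_right _ ((Finset.card_filter_le _ _).trans ?_)
        simp

/-- A lower set of exponent vectors whose count grows at least like a polynomial of degree `d`
contains all exponent vectors supported on some `d` of the variables. -/
theorem exists_finset_of_countLT_growth {n d : ℕ} {D : Set (Fin n →₀ ℕ)} (hD : IsLowerSet D)
    {c : ℚ} (hc : 0 < c) {K : ℕ} (h : ∀ j : ℕ, c * (j : ℚ) ^ d ≤ countLT D (j + K)) :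
    ∃ A : Finset (Fin n), A.card = d ∧ ∀ a : Fin n →₀ ℕ, a.support ⊆ A → a ∈ D := by
  classical
  by_contra! hA
  cases d with
  | zero =>
    -- Here `0 ∉ D`, so `D` is empty, while `h 0` reads `c ≤ 0` because `0 ^ 0 = 1`.
    obtain ⟨a, ha, haD⟩ := hA ∅ rfl
    have h0 : countLT D (0 + K) = 0 := by
      refine Finset.card_eq_zero.2 (Finset.filter_eq_empty_iff.2 fun b _ hb => haD (hD ?_ hb))
      rw [Finset.subset_empty, Finsupp.support_eq_empty] at ha
      simp [ha]
    have := h 0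
    rw [h0] at this
    simp at this
    exact absurd this (not_le.2 hc)
  | succ e =>
    obtain ⟨C, hC⟩ := countLT_le_of_forall_exists_notMem hD hA
    -- At `j = m + K + 1` one has `j + K ≤ 2 * j`, which is the source of `2 ^ e`; then `c * j ≤ C *
    -- 2 ^ e` contradicts the choice of `m`.
    obtain ⟨m, hm⟩ := exists_nat_gt ((C : ℚ) * 2 ^ e / c)
    have h1 := (h (m + K + 1)).trans (Nat.cast_le.2 (hC (m + K + 1 + K)))
    push_cast at h1
    rw [div_lt_iff₀ hc] at hm
    have hx : (0 : ℚ) < (m + K + 1 : ℚ) := by positivity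
    have h2 : ((m : ℚ) + K + 1 + K) ^ e ≤ 2 ^ e * (m + K + 1 : ℚ) ^ e := by
      rw [← mul_pow]
      refine pow_le_pow_left₀ (by positivity) ?_ e
      have : (0 : ℚ) ≤ m := by positivity
      linarith
    have h3 : c * (m + K + 1 : ℚ) ^ (e + 1) ≤ C * 2 ^ e * (m + K + 1 : ℚ) ^ e := by
      refine h1.trans ?_
      rw [mul_assoc]
      exact mul_le_mul_of_nonneg_left h2 (by positivity)
    rw [pow_succ, ← mul_assoc, mul_right_comm] at h3
    have h4 := le_of_mul_le_mul_right h3 (by positivity)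
    have : (0 : ℚ) ≤ K := by positivity
    nlinarith

theorem sum_range_multichoose (d m : ℕ) :
    ∑ t ∈ Finset.range (m + 1), d.multichoose t = (d + 1).multichoose m := by
  induction m with
  | zero => simp
  | succ m ih => rw [Finset.sum_range_succ, ih, Nat.multichoose_succ_succ, add_comm]

/-- With `d = A.card`, the monomials of degree less than `k` in the variables of `A` number `(k + d
- 1).choose d`, and `d!` times this is `k (k + 1) ⋯ (k + d - 1)`. -/
theorem pow_le_factorial_mul_countLT {n : ℕ} {D : Set (Fin n →₀ ℕ)} (A : Finset (Fin n))
    (hA : ∀ a : Fin n →₀ ℕ, a.support ⊆ A → a ∈ D) {k : ℕ} (hk : 0 < k) :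
    k ^ A.card ≤ A.card.factorial * countLT D k := by
  classical
  have h1 : ∑ t ∈ Finset.range k, (A.finsuppAntidiag t).card ≤ countLT D k := by
    rw [← Finset.card_biUnion]
    · refine Finset.card_le_card fun a ha => ?_
      simp only [Finset.mem_biUnion, Finset.mem_range, Finset.mem_finsuppAntidiag] at ha
      obtain ⟨t, ht, hat, hs⟩ := ha
      simp only [Finset.mem_filter, mem_exponentsLT]
      refine ⟨?_, hA a hs⟩
      rw [Finsupp.degree_apply, Finset.sum_subset hs, hat]
      · exact ht
      · intro i _ hi
        simpa using hi
    · intro t _ t' _ htt'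
      exact Finset.disjoint_left.2 fun a ha ha' => htt' (by
        rw [Finset.mem_finsuppAntidiag] at ha ha'
        exact ha.1.symm.trans ha'.1)
  refine le_trans ?_ (Nat.mul_le_mul_left _ h1)
  obtain ⟨m, rfl⟩ := Nat.exists_eq_succ_of_ne_zero hk.ne'
  simp only [Finset.card_finsuppAntidiag_nat_eq_multichoose, Nat.succ_eq_add_one]
  rw [sum_range_multichoose, Nat.multichoose_eq, Nat.add_right_comm, Nat.add_sub_cancel,
    Nat.add_comm A.card, Nat.choose_symm_add, ← Nat.ascFactorial_eq_factorial_mul_choose]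
  exact Nat.pow_succ_le_ascFactorial _ _

/-! ### Standard monomials and Hilbert functions -/

section standardExponents

open Classical in
-- Adding the vectors in the order given by `o`, the dimension rises by one exactly when the new
-- vector is outside the span of the earlier ones.
theorem finrank_span_image_eq_card {K V ι κ : Type*} [Field K] [AddCommGroup V] [Module K V]
    [LinearOrder κ] (v : ι → V) {o : ι → κ} (ho : Function.Injective o) (s : Finset ι) :
    Module.finrank K (Submodule.span K (v '' s)) =
      (s.filter fun i => v i ∉ Submodule.span K (v '' {j | j ∈ s ∧ o j < o i})).card := by
  induction s using Finset.induction_on_max_value o with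
  | empty =>
    rw [Finset.coe_empty, Set.image_empty, Submodule.span_empty, finrank_bot]
    rfl
  | insert i s his hi ih =>
    replace hi : ∀ j ∈ s, o j < o i := fun j hj =>
      lt_of_le_of_ne (hi j hj) fun h => his (ho h ▸ hj)
    have h1 : {j | j ∈ insert i s ∧ o j < o i} = (s : Set ι) := by
      ext j
      simp only [Finset.mem_insert, Set.mem_ofPred_eq, Finset.mem_coe]
      exact ⟨fun h => h.1.resolve_left fun e => h.2.ne (e ▸ rfl), fun h => ⟨Or.inr h, hi j h⟩⟩
    have h2 : ∀ k ∈ s, {j | j ∈ insert i s ∧ o j < o k} = {j | j ∈ s ∧ o j < o k} := by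
      intro k hk
      ext j
      simp only [Finset.mem_insert, Set.mem_ofPred_eq]
      exact ⟨fun h => ⟨h.1.resolve_left fun e => (h.2.trans (hi k hk)).ne (e ▸ rfl), h.2⟩, fun h => ⟨Or.inr h.1, h.2⟩⟩
    have h3 : (s.filter fun k => v k ∉ Submodule.span K (v '' {j | j ∈ insert i s ∧ o j < o k})) =
        s.filter fun k => v k ∉ Submodule.span K (v '' {j | j ∈ s ∧ o j < o k}) :=
      Finset.filter_congr fun k hk => by rw [h2 k hk]
    rw [Finset.filter_insert, h1, h3, Finset.coe_insert, Set.image_insert_eq,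
      Submodule.span_insert]
    have hfd : FiniteDimensional K (Submodule.span K (v '' (s : Set ι))) :=
      FiniteDimensional.span_of_finite K (s.finite_toSet.image v)
    by_cases hv : v i ∉ Submodule.span K (v '' (s : Set ι))
    · rw [if_pos hv, Finset.card_insert_of_notMem (fun h => his (Finset.mem_filter.1 h).1), ← ih]
      have h0 : v i ≠ 0 := fun h => hv (h ▸ Submodule.zero_mem _)
      have hd : Disjoint (Submodule.span K {v i}) (Submodule.span K (v '' (s : Set ι))) :=
        ((Submodule.disjoint_span_singleton' h0).2 hv).symm
      have := Submodule.finrank_sup_add_finrank_inf_eq (Submodule.span K {v i})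
        (Submodule.span K (v '' (s : Set ι)))
      rw [hd.eq_bot, finrank_bot, finrank_span_singleton h0] at this
      omega
    · rw [if_neg hv]
      rw [not_not] at hv
      rw [← ih, sup_eq_right.2 ((Submodule.span_singleton_le_iff_mem _ _).2 hv)]

variable {F : Type*} [Field F] {n : ℕ} {R : Type*} [CommRing R] [Algebra F R]

/-- The exponent vectors of the monomials whose images under `φ` are not linear combinations of
the images of the smaller monomials in the degree-lexicographic order. -/
def standardExponents (φ : MvPolynomial (Fin n) F →ₐ[F] R) : Set (Fin n →₀ ℕ) :=
  {a | φ (monomial a 1) ∉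
    Submodule.span F ((fun b => φ (monomial b 1)) '' {b | toDegLex b < toDegLex a})}

/-- The exponent vectors of the monomials whose images under `φ` are not linear combinations of
the images of the greater monomials in the degree-lexicographic order. -/
def localStandardExponents (φ : MvPolynomial (Fin n) F →ₐ[F] R) : Set (Fin n →₀ ℕ) :=
  {a | φ (monomial a 1) ∉
    Submodule.span F ((fun b => φ (monomial b 1)) '' {b | toDegLex a < toDegLex b})}

/-- A linear relation may be multiplied by a monomial. As the order is compatible with addition,
divisors of standard monomials are standard, for either direction of the order. -/
theorem map_monomial_add_mem_span {φ : MvPolynomial (Fin n) F →ₐ[F] R} {a c : Fin n →₀ ℕ}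
    {s t : Set (Fin n →₀ ℕ)} (hst : ∀ b ∈ s, b + c ∈ t)
    (h : φ (monomial a 1) ∈ Submodule.span F ((fun b => φ (monomial b 1)) '' s)) :
    φ (monomial (a + c) 1) ∈ Submodule.span F ((fun b => φ (monomial b 1)) '' t) := by
  have key : ∀ x ∈ Submodule.span F ((fun b => φ (monomial b 1)) '' s),
      x * φ (monomial c 1) ∈ Submodule.span F ((fun b => φ (monomial b 1)) '' t) := by
    intro x hx
    induction hx using Submodule.span_induction with
    | mem x hx =>
      obtain ⟨b, hb, rfl⟩ := hx
      refine Submodule.subset_span ⟨b + c, hst b hb, ?_⟩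
      simp only [← map_mul, monomial_mul, one_mul]
    | zero => simp
    | add x y _ _ hx hy => rw [add_mul]; exact Submodule.add_mem _ hx hy
    | smul r x _ hx => rw [smul_mul_assoc]; exact Submodule.smul_mem _ _ hx
  have := key _ h
  rwa [← map_mul, monomial_mul, one_mul] at this

theorem isLowerSet_standardExponents (φ : MvPolynomial (Fin n) F →ₐ[F] R) :
    IsLowerSet (standardExponents φ) := by
  intro a b hba ha hb
  obtain ⟨c, rfl⟩ := exists_add_of_le hba
  refine ha (map_monomial_add_mem_span (fun x hx => ?_) hb)
  simp only [Set.mem_ofPred_eq, toDegLex_add] at hx ⊢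
  exact add_lt_add_left hx _

theorem isLowerSet_localStandardExponents (φ : MvPolynomial (Fin n) F →ₐ[F] R) :
    IsLowerSet (localStandardExponents φ) := by
  intro a b hba ha hb
  obtain ⟨c, rfl⟩ := exists_add_of_le hba
  refine ha (map_monomial_add_mem_span (fun x hx => ?_) hb)
  simp only [Set.mem_ofPred_eq, toDegLex_add] at hx ⊢
  exact add_lt_add_left hx _

/-- The affine Hilbert function: the dimension of the image of the space of polynomials of total
degree less than `k`. -/
def affineHilbert (φ : MvPolynomial (Fin n) F →ₐ[F] R) (k : ℕ) : ℕ :=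
  Module.finrank F
    (Submodule.span F ((fun b => φ (monomial b 1)) '' (exponentsLT n k : Set (Fin n →₀ ℕ))))

theorem degree_le_of_toDegLex_lt {a b : Fin n →₀ ℕ} (h : toDegLex a < toDegLex b) :
    a.degree ≤ b.degree :=
  Finsupp.DegLex.monotone_degree h.le

theorem affineHilbert_eq_countLT (φ : MvPolynomial (Fin n) F →ₐ[F] R) (k : ℕ) :
    affineHilbert φ k = countLT (standardExponents φ) k := by
  classical
  unfold affineHilbert countLT
  have := finrank_span_image_eq_card (K := F) (fun b : Fin n →₀ ℕ => φ (monomial b 1))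
    toDegLex_injective (exponentsLT n k)
  refine this.trans (congrArg Finset.card (Finset.ext fun a => ?_))
  refine Finset.mem_filter.trans (Iff.trans ?_ Finset.mem_filter.symm)
  refine and_congr_right fun ha => ?_
  -- The order compares degrees first, so the degree bound on `j` is automatic.
  have hs : {j | j ∈ exponentsLT n k ∧ toDegLex j < toDegLex a} =
      {b | toDegLex b < toDegLex a} := by
    ext b
    refine ⟨fun h => h.2, fun h => ⟨?_, h⟩⟩
    rw [mem_exponentsLT] at ha ⊢
    exact (degree_le_of_toDegLex_lt h).trans_lt ha
  rw [hs]
  rfl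

theorem eventuallyPolynomial_affineHilbert (φ : MvPolynomial (Fin n) F →ₐ[F] R) :
    EventuallyPolynomial fun k => (affineHilbert φ k : ℚ) := by
  simp only [affineHilbert_eq_countLT]
  exact eventuallyPolynomial_countLT (isLowerSet_standardExponents φ)

theorem span_map_monomial (φ : MvPolynomial (Fin n) F →ₐ[F] R) (s : Set (Fin n →₀ ℕ)) :
    Submodule.span F ((fun b => φ (monomial b 1)) '' s) =
      (restrictSupport F s).map φ.toLinearMap := by
  rw [restrictSupport_eq_span, Submodule.map_span, ← Set.image_comp]
  rfl

theorem pow_map_idealOfVars {φ : MvPolynomial (Fin n) F →ₐ[F] R}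
    (hφ : Function.Surjective φ) (k : ℕ) :
    (((idealOfVars (Fin n) F).map φ) ^ k).restrictScalars F =
      Submodule.span F ((fun b => φ (monomial b 1)) '' {b | k ≤ b.degree}) := by
  rw [span_map_monomial]
  ext x
  rw [Submodule.restrictScalars_mem, ← Ideal.map_pow, Ideal.mem_map_iff_of_surjective φ hφ,
    Submodule.mem_map]
  simp only [mem_pow_idealOfVars_iff, mem_restrictSupport_iff, Set.subset_def,
    Finset.mem_coe, Set.mem_ofPred_eq, AlgHom.toLinearMap_apply]

theorem span_quotient_pow_map_idealOfVars {φ : MvPolynomial (Fin n) F →ₐ[F] R}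
    (hφ : Function.Surjective φ) (k : ℕ) :
    Submodule.span F ((fun b => Ideal.Quotient.mkₐ F (((idealOfVars (Fin n) F).map φ) ^ k)
      (φ (monomial b 1))) '' (exponentsLT n k : Set (Fin n →₀ ℕ))) = ⊤ := by
  rw [eq_top_iff]
  rintro x -
  obtain ⟨y, rfl⟩ := Ideal.Quotient.mkₐ_surjective F _ x
  obtain ⟨f, rfl⟩ := hφ y
  induction f using MvPolynomial.induction_on' with
  | monomial a r =>
    rw [← mul_one r, ← smul_eq_mul, ← smul_monomial, map_smul, map_smul]
    refine Submodule.smul_mem _ _ ?_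
    by_cases ha : a.degree < k
    · exact Submodule.subset_span ⟨a, by simpa using ha, rfl⟩
    · convert Submodule.zero_mem _
      refine Ideal.Quotient.eq_zero_iff_mem.2 ?_
      rw [← Submodule.restrictScalars_mem F, pow_map_idealOfVars hφ]
      exact Submodule.subset_span ⟨a, not_lt.1 ha, rfl⟩
  | add p q hp hq => rw [map_add, map_add]; exact Submodule.add_mem _ hp hq

theorem finiteDimensional_quotient_pow {φ : MvPolynomial (Fin n) F →ₐ[F] R}
    (hφ : Function.Surjective φ) (k : ℕ) :
    FiniteDimensional F (R ⧸ ((idealOfVars (Fin n) F).map φ) ^ k) :=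
  Module.finite_def.2 <| (span_quotient_pow_map_idealOfVars hφ k) ▸
    Submodule.fg_span ((exponentsLT n k).finite_toSet.image _)

/-- Monomials of degree at least `k` span the `k`-th power and exceed every monomial of smaller
degree. Hence reducing modulo that power does not change which monomials of degree less than `k`
depend on greater ones. -/
theorem finrank_quotient_pow_eq_countLT {φ : MvPolynomial (Fin n) F →ₐ[F] R}
    (hφ : Function.Surjective φ) (k : ℕ) :
    Module.finrank F (R ⧸ ((idealOfVars (Fin n) F).map φ) ^ k) =
      countLT (localStandardExponents φ) k := by
  classical
  set m := (idealOfVars (Fin n) F).map φ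
  let π := (Ideal.Quotient.mkₐ F (m ^ k)).toLinearMap
  have hker : LinearMap.ker π = (m ^ k).restrictScalars F := by
    ext x
    simp [π, Ideal.Quotient.eq_zero_iff_mem]
  -- The order is dualized, so that the earlier monomials are the greater ones.
  have := finrank_span_image_eq_card (K := F) (fun b : Fin n →₀ ℕ => π (φ (monomial b 1)))
    (OrderDual.toDual.injective.comp toDegLex_injective) (exponentsLT n k)
  rw [← finrank_top, ← span_quotient_pow_map_idealOfVars hφ k]
  refine this.trans (congrArg Finset.card (Finset.ext fun a => ?_))
  refine Finset.mem_filter.trans (Iff.trans ?_ Finset.mem_filter.symm)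
  refine and_congr_right fun ha => not_congr ?_
  change π (φ (monomial a 1)) ∈ Submodule.span F ((fun b => π (φ (monomial b 1))) ''
      {b | b ∈ exponentsLT n k ∧ toDegLex a < toDegLex b}) ↔ _
  have hspan : Submodule.span F ((fun b => π (φ (monomial b 1))) ''
      {b | b ∈ exponentsLT n k ∧ toDegLex a < toDegLex b}) =
      (Submodule.span F ((fun b => φ (monomial b 1)) ''
        {b | b ∈ exponentsLT n k ∧ toDegLex a < toDegLex b})).map π := by
    rw [Submodule.map_span, ← Set.image_comp]
    rfl
  rw [hspan, ← Submodule.mem_comap, Submodule.comap_map_eq, hker, pow_map_idealOfVars hφ, ← Submodule.span_union,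
    ← Set.image_union]
  have hset : {b | b ∈ exponentsLT n k ∧ toDegLex a < toDegLex b} ∪ {b | k ≤ b.degree} =
      {b | toDegLex a < toDegLex b} := by
    rw [mem_exponentsLT] at ha
    ext b
    simp only [Set.mem_union, Set.mem_ofPred_eq, mem_exponentsLT]
    refine ⟨?_, fun h => ?_⟩
    · rintro (h | h)
      · exact h.2
      · exact Finsupp.DegLex.lt_iff.2 (Or.inl (lt_of_lt_of_le ha h))
    · rcases lt_or_ge b.degree k with hb | hb
      · exact Or.inl ⟨hb, h⟩
      · exact Or.inr hb
  rw [hset]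

/-- The leading monomial of an algebraic relation would be a combination of smaller monomials,
although it involves only variables of `A`. -/
theorem algebraicIndependent_of_standardExponents {φ : MvPolynomial (Fin n) F →ₐ[F] R}
    {A : Finset (Fin n)} (hA : ∀ a : Fin n →₀ ℕ, a.support ⊆ A → a ∈ standardExponents φ) :
    AlgebraicIndependent F fun i : A => φ (X (i : Fin n)) := by
  rw [algebraicIndependent_iff]
  intro f hf
  by_contra hne
  set g := rename (Subtype.val : A → Fin n) f
  have hg : g ≠ 0 := fun h => hne (rename_injective _ Subtype.val_injective (by simpa [g] using h))
  have hφg : φ g = 0 := by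
    rw [← hf, aeval_unique φ, aeval_rename]
    simp only [aeval_X]
    rfl
  have hsupp : ∀ a ∈ g.support, a.support ⊆ A := by
    intro a ha i hi
    have h1 : i ∈ g.vars := (mem_vars_iff_mem_support i).2 ⟨a, ha, hi⟩
    obtain ⟨j, -, rfl⟩ := Finset.mem_image.1 (vars_rename _ f h1)
    exact j.2
  obtain ⟨a, ha, hmax⟩ := Finset.exists_max_image g.support toDegLex (support_nonempty.2 hg)
  refine hA a (hsupp a ha) ?_
  have h1 : g = ∑ b ∈ g.support, monomial b (coeff b g) := g.as_sum
  rw [h1, map_sum, ← Finset.add_sum_erase _ _ ha] at hφg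
  have h2 : ∀ b, φ (monomial b (coeff b g)) = coeff b g • φ (monomial b 1) := fun b => by
    rw [← map_smul, smul_monomial, smul_eq_mul, mul_one]
  simp only [h2] at hφg
  rw [mem_support_iff] at ha
  have h3 : φ (monomial a 1) =
      (coeff a g)⁻¹ • -∑ b ∈ g.support.erase a, coeff b g • φ (monomial b 1) := by
    rw [← eq_neg_of_add_eq_zero_left hφg, smul_smul, inv_mul_cancel₀ ha, one_smul]
  rw [h3]
  refine Submodule.smul_mem _ _ (Submodule.neg_mem _ (Submodule.sum_mem _ fun b hb => ?_))
  refine Submodule.smul_mem _ _ (Submodule.subset_span ⟨b, ?_, rfl⟩)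
  rw [Finset.mem_erase] at hb
  exact lt_of_le_of_ne (hmax b hb.2) fun h => hb.1 (toDegLex_injective h)

end standardExponents

/-! ### Dimension theory of finitely generated domains -/

/-- By the Nullstellensatz for Jacobson rings, a maximal ideal contracts to a maximal ideal in one
variable fewer, and the height drops by exactly one. -/
theorem le_height_of_isMaximal_mvPolynomial {F : Type*} [Field F] {s : ℕ}
    (M : Ideal (MvPolynomial (Fin s) F)) [hM : M.IsMaximal] : (s : ℕ∞) ≤ M.height := by
  induction s with
  | zero => simp
  | succ s ih =>
    let e := (finSuccEquiv F s).toRingEquiv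
    rw [← e.height_map M]
    have h1 : (M.map e).IsMaximal := Ideal.map_isMaximal_of_equiv e
    have h2 : ((M.map e).under (MvPolynomial (Fin s) F)).IsMaximal :=
      Polynomial.isMaximal_comap_C_of_isJacobsonRing (M.map e)
    have h3 : (M.map e).LiesOver ((M.map e).under (MvPolynomial (Fin s) F)) := ⟨rfl⟩
    rw [Polynomial.height_eq_height_add_one ((M.map e).under (MvPolynomial (Fin s) F)) (M.map e)]
    push_cast
    gcongr
    exact ih _

/-- A finitely generated domain over a field is equidimensional, and its dimension is its
transcendence degree. -/
theorem exists_dimension_of_finiteType (F R : Type*) [Field F] [CommRing R] [IsDomain R]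
    [Algebra F R] [Algebra.FiniteType F R] :
    ∃ s : ℕ, ringKrullDim R ≤ s ∧
      (∀ {n : ℕ} {A : Finset (Fin n)} {x : A → R}, AlgebraicIndependent F x → A.card ≤ s) ∧
      ∀ M : Ideal R, ∀ hM : M.IsMaximal, ∃ l : LTSeries (PrimeSpectrum R), l.length = s ∧
        l.last = ⟨M, hM.isPrime⟩ := by
  -- Noether normalization: `R` is integral over a polynomial ring in `s` variables. Incomparability
  -- bounds the dimension, and going down lifts chains.
  obtain ⟨s, g, hg, hint⟩ := exists_integral_inj_algHom_of_fg F R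
  algebraize [g.toRingHom]
  have hint' : Algebra.IsIntegral (MvPolynomial (Fin s) F) R := ⟨hint⟩
  have hinj : Function.Injective (algebraMap (MvPolynomial (Fin s) F) R) := hg
  have hfaith : FaithfulSMul (MvPolynomial (Fin s) F) R :=
    (faithfulSMul_iff_algebraMap_injective _ _).2 hinj
  have htower : IsScalarTower F (MvPolynomial (Fin s) F) R :=
    IsScalarTower.of_algebraMap_eq fun x => (g.commutes x).symm
  refine ⟨s, ?_, ?_, ?_⟩
  · have h1 : ringKrullDim R ≤ ringKrullDim (MvPolynomial (Fin s) F) :=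
      Order.krullDim_le_of_strictMono (PrimeSpectrum.comap (algebraMap (MvPolynomial (Fin s) F) R))
        fun p q hpq => by
          have := Ideal.IsIntegral.comap_lt_comap (R := MvPolynomial (Fin s) F)
            ((PrimeSpectrum.asIdeal_lt_asIdeal p q).2 hpq)
          exact this
    refine h1.trans ?_
    rw [MvPolynomial.ringKrullDim_of_isNoetherianRing]
    simp
  · intro n A x hx
    have h1 := hx.lift_cardinalMk_le_trdeg
    have h2 := lift_trdeg_add_eq F (MvPolynomial (Fin s) F) R
    rw [_root_.trdeg_eq_zero (R := MvPolynomial (Fin s) F), MvPolynomial.trdeg_of_isDomain] at h2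
    simp at h1 h2
    rw [← h2] at h1
    simpa using h1
  · intro M hM
    have hM' : (M.under (MvPolynomial (Fin s) F)).IsMaximal :=
      Ideal.isMaximal_comap_of_isIntegral_of_isMaximal M
    have h1 := le_height_of_isMaximal_mvPolynomial (M.under (MvPolynomial (Fin s) F))
    obtain ⟨l, hl, hlen⟩ :=
      (M.under (MvPolynomial (Fin s) F)).exists_ltSeries_length_eq_height
    rw [← hlen, Nat.cast_le] at h1
    -- Only the last `s` steps of the chain are kept, so that the lifted chain has length exactly
    -- `s`.
    have hlast : M.LiesOver (l.drop ⟨l.length - s, by omega⟩).last.asIdeal := by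
      rw [RelSeries.last_drop, hl]
      exact ⟨rfl⟩
    obtain ⟨L, hL, hLl, -⟩ := Ideal.exists_ltSeries_of_hasGoingDown
      (l.drop ⟨l.length - s, _⟩) M
    refine ⟨L, ?_, hLl⟩
    rw [hL]
    simp
    omega

/-! ### Growth of Hilbert–Samuel functions along chains of primes -/

section growth

variable {F R : Type*} [Field F] [CommRing R] [Algebra F R]

/-- By the Artin–Rees lemma, multiplication by an element outside of a prime ideal shifts the
powers of an ideal by a bounded amount only. -/
theorem exists_mem_sup_pow_of_mul_mem [IsNoetherianRing R] (q m : Ideal R) [hq : q.IsPrime]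
    {x : R} (hx : x ∉ q) : ∃ c : ℕ, 0 < c ∧ ∀ k r, x * r ∈ q ⊔ m ^ (k + c) → r ∈ q ⊔ m ^ k := by
  obtain ⟨c, hc⟩ := Ideal.exists_pow_inf_eq_pow_smul m
    (Submodule.span R {(Ideal.Quotient.mk q x : R ⧸ q)})
  refine ⟨c + 1, Nat.succ_pos _, fun k r hr => ?_⟩
  have hmem : (Ideal.Quotient.mk q (x * r) : R ⧸ q) ∈
      (m ^ (k + (c + 1)) • ⊤ ⊓ Submodule.span R {(Ideal.Quotient.mk q x : R ⧸ q)} :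
        Submodule R (R ⧸ q)) := by
    refine ⟨?_, Submodule.mem_span_singleton.2 ⟨r, ?_⟩⟩
    · obtain ⟨a, ha, b, hb, hab⟩ := Submodule.mem_sup.1 hr
      rw [← hab, map_add, Ideal.Quotient.eq_zero_iff_mem.2 ha, zero_add, ← mul_one b]
      exact Submodule.smul_mem_smul hb (Submodule.mem_top (x := (1 : R ⧸ q)))
    · rw [mul_comm, map_mul]
      rfl
  rw [hc _ (by omega)] at hmem
  have h2 : (Ideal.Quotient.mk q (x * r) : R ⧸ q) ∈
      m ^ k • Submodule.span R {(Ideal.Quotient.mk q x : R ⧸ q)} :=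
    Submodule.smul_mono (Ideal.pow_le_pow_right (by omega)) inf_le_right hmem
  obtain ⟨b, hb, hbx⟩ := Submodule.mem_smul_span_singleton.1 h2
  -- Artin–Rees gives `x * r ≡ x * b` modulo `q` with `b ∈ m ^ k`; as `q` is prime, `x` can be
  -- cancelled.
  have h3 : x * (r - b) ∈ q := by
    rw [← Ideal.Quotient.eq_zero_iff_mem, mul_sub, map_sub, sub_eq_zero, ← hbx, mul_comm x b,
      map_mul (Ideal.Quotient.mk q) b]
    rfl
  have h4 := (hq.mem_or_mem h3).resolve_left hx
  exact Submodule.mem_sup.2 ⟨r - b, h4, b, hb, sub_add_cancel _ _⟩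

/-- Multiplication by `x` maps `R` into the kernel of `R ⧸ I₁ → R ⧸ I₃`, and its image has dimension
at least that of `R ⧸ I₂`. -/
theorem finrank_add_finrank_le_of_mul {I₁ I₂ I₃ : Ideal R} {x : R}
    [FiniteDimensional F (R ⧸ I₁)] (h1 : ∀ r, x * r ∈ I₁ → r ∈ I₂) (hx : x ∈ I₃)
    (hI : I₁ ≤ I₃) :
    Module.finrank F (R ⧸ I₂) + Module.finrank F (R ⧸ I₃) ≤ Module.finrank F (R ⧸ I₁) := by
  let f : (R ⧸ I₁) →ₗ[F] (R ⧸ I₃) := (Ideal.Quotient.factorₐ F hI).toLinearMap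
  have hf : Function.Surjective f := Ideal.Quotient.factor_surjective hI
  let μ : R →ₗ[F] (R ⧸ I₁) :=
    (Ideal.Quotient.mkₐ F I₁).toLinearMap ∘ₗ LinearMap.mulLeft F x
  have hker : LinearMap.ker μ ≤ LinearMap.ker (Ideal.Quotient.mkₐ F I₂).toLinearMap := by
    intro r hr
    rw [LinearMap.mem_ker] at hr ⊢
    exact Ideal.Quotient.eq_zero_iff_mem.2 (h1 r (Ideal.Quotient.eq_zero_iff_mem.1 hr))
  have hle : LinearMap.range μ ≤ LinearMap.ker f := by
    rintro _ ⟨r, rfl⟩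
    rw [LinearMap.mem_ker]
    exact Ideal.Quotient.eq_zero_iff_mem.2 (I₃.mul_mem_right r hx)
  have h2 : Module.finrank F (R ⧸ I₂) ≤ Module.finrank F (LinearMap.range μ) := by
    rw [← μ.quotKerEquivRange.finrank_eq]
    have hfin : FiniteDimensional F (R ⧸ LinearMap.ker μ) :=
      FiniteDimensional.of_injective μ.quotKerEquivRange.toLinearMap μ.quotKerEquivRange.injective
    refine LinearMap.finrank_le_finrank_of_surjective
      (f := (LinearMap.ker μ).liftQ (Ideal.Quotient.mkₐ F I₂).toLinearMap hker) ?_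
    intro y
    obtain ⟨r, rfl⟩ := Ideal.Quotient.mkₐ_surjective F I₂ y
    exact ⟨Submodule.Quotient.mk r, rfl⟩
  have h3 := Submodule.finrank_mono hle
  have h4 := f.finrank_range_add_finrank_ker
  rw [LinearMap.range_eq_top.2 hf, finrank_top] at h4
  omega

theorem pow_succ_le_add (a c : ℚ) (ha : 0 ≤ a) (hc : 0 ≤ c) (e : ℕ) :
    (a + c) ^ (e + 1) ≤ a ^ (e + 1) + c * (e + 1) * (a + c) ^ e := by
  induction e with
  | zero => simp
  | succ e ih =>
    have h1 : (a + c) ^ (e + 1 + 1) = (a + c) ^ (e + 1) * a + c * (a + c) ^ (e + 1) := by ring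
    have h2 := mul_le_mul_of_nonneg_right ih ha
    have h3 : c * (e + 1) * (a + c) ^ e * a ≤ c * (e + 1) * (a + c) ^ (e + 1) := by
      rw [pow_succ, ← mul_assoc]
      exact mul_le_mul_of_nonneg_left (by linarith) (by positivity)
    rw [h1]
    push_cast
    have h4 : a ^ (e + 1 + 1) = a ^ (e + 1) * a := pow_succ _ _
    rw [h4]
    nlinarith

/-- A discrete integration: increments of order `j ^ d`, taken in steps of length `c`, sum to order
`j ^ (d + 1)`. -/
theorem exists_growth_of_le_add {h g : ℕ → ℕ} {c d K : ℕ} {a : ℚ} (hc : 0 < c) (ha : 0 < a)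
    (hg : ∀ j : ℕ, a * (j : ℚ) ^ d ≤ g (j + K)) (hh : ∀ k, h k + g (k + c) ≤ h (k + c)) :
    ∃ b : ℚ, 0 < b ∧ ∀ j : ℕ, b * (j : ℚ) ^ (d + 1) ≤ h (j + (K + c)) := by
  have hcQ : (0 : ℚ) < c := by exact_mod_cast hc
  have hb : a / (c * (d + 1)) * (c * (d + 1)) = a := by field_simp
  -- Chosen so that `b * ((i + c) ^ (d + 1) - i ^ (d + 1)) ≤ a * (i + c) ^ d`.
  set b := a / (c * (d + 1)) with hbdef
  have hb0 : 0 < b := by positivity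
  refine ⟨b, hb0, fun j => ?_⟩
  induction j using Nat.strong_induction_on with
  | _ j ih =>
    have h1 : (h (j + K) : ℚ) + g (j + c + K) ≤ h (j + (K + c)) := by
      have := hh (j + K)
      rw [show j + K + c = j + c + K by omega] at this
      rw [show j + (K + c) = j + c + K by omega]
      exact_mod_cast this
    have h2 := hg (j + c)
    push_cast at h2
    rcases lt_or_ge j c with hj | hj
    -- For `j < c` a single increment is enough, since `b * j ≤ a`.
    · have h0 : (0 : ℚ) ≤ h (j + K) := by positivity
      have h3 : b * (j : ℚ) ^ (d + 1) ≤ a * ((j : ℚ) + c) ^ d := by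
        rw [pow_succ]
        have h5 : (j : ℚ) ^ d ≤ ((j : ℚ) + c) ^ d :=
          pow_le_pow_left₀ (by positivity) (by linarith) d
        have h6 : b * j ≤ a := by
          rw [← hb]
          refine mul_le_mul_of_nonneg_left ?_ hb0.le
          have : (j : ℚ) ≤ c := by exact_mod_cast hj.le
          have hd : (0 : ℚ) ≤ d := by positivity
          nlinarith
        calc b * ((j : ℚ) ^ d * j) = (b * j) * (j : ℚ) ^ d := by ring
          _ ≤ a * ((j : ℚ) + c) ^ d := mul_le_mul h6 h5 (by positivity) ha.le
      linarith
    · obtain ⟨i, rfl⟩ := Nat.exists_eq_add_of_le' hj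
      have h3 := ih i (by omega)
      rw [show i + (K + c) = i + c + K by omega] at h3
      have h4 := mul_le_mul_of_nonneg_left
        (pow_succ_le_add i c (by positivity) hcQ.le d) hb0.le
      have h5 : ((i : ℚ) + c) ^ d ≤ ((i : ℚ) + c + c) ^ d :=
        pow_le_pow_left₀ (by positivity) (by linarith) d
      have h6 := mul_le_mul_of_nonneg_left h5 ha.le
      push_cast at h1 h2 ⊢
      have h7 : b * (c * (d + 1) * ((i : ℚ) + c) ^ d) = a * ((i : ℚ) + c) ^ d := by
        rw [← mul_assoc, hb]
      rw [mul_add, h7] at h4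
      linarith

/-- Each prime `q` prepended to the chain raises the exponent by one: multiplication by an element
of the next prime outside `q` bounds the increments of the function for `q` below by the function
for the next prime. -/
theorem exists_growth_of_ltSeries [IsNoetherianRing R] {m : Ideal R}
    (hfin : ∀ k, FiniteDimensional F (R ⧸ m ^ k)) (l : LTSeries (PrimeSpectrum R))
    (hl : l.last.asIdeal = m) :
    ∃ a : ℚ, 0 < a ∧ ∃ K : ℕ, ∀ j : ℕ, a * (j : ℚ) ^ l.length ≤
      Module.finrank F (R ⧸ (l.head.asIdeal ⊔ m ^ (j + K))) := by
  have hfin' : ∀ (q : Ideal R) (k : ℕ), FiniteDimensional F (R ⧸ (q ⊔ m ^ k)) := fun q k =>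
    have := hfin k
    Module.Finite.of_surjective
      (Ideal.Quotient.factorₐ F (le_sup_right : m ^ k ≤ q ⊔ m ^ k)).toLinearMap
      (Ideal.Quotient.factor_surjective le_sup_right)
  induction l using RelSeries.inductionOn with
  | singleton p =>
    refine ⟨1, one_pos, 1, fun j => ?_⟩
    have hp : p.asIdeal = m := hl
    have hne : (RelSeries.singleton _ p : LTSeries (PrimeSpectrum R)).head.asIdeal ⊔ m ^ (j + 1) =
        p.asIdeal := by
      rw [RelSeries.head_singleton, ← hp]
      exact sup_eq_left.2 (Ideal.pow_le_self (by omega))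
    have := hfin' (RelSeries.singleton _ p : LTSeries (PrimeSpectrum R)).head.asIdeal (j + 1)
    rw [hne] at this ⊢
    have : 0 < Module.finrank F (R ⧸ p.asIdeal) := Module.finrank_pos
    simp only [RelSeries.singleton_length, pow_zero, mul_one]
    exact_mod_cast this
  | cons l q hlt ih =>
    rw [RelSeries.last_cons] at hl
    obtain ⟨a, ha, K, hK⟩ := ih hl
    have hq : q.asIdeal < l.head.asIdeal := hlt
    obtain ⟨x, hx, hxq⟩ := SetLike.exists_of_lt hq
    obtain ⟨c, hc0, hc⟩ := exists_mem_sup_pow_of_mul_mem q.asIdeal m hxq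
    obtain ⟨b, hb, hbj⟩ := exists_growth_of_le_add (d := l.length)
      (h := fun k => Module.finrank F (R ⧸ (q.asIdeal ⊔ m ^ k)))
      (g := fun k => Module.finrank F (R ⧸ (l.head.asIdeal ⊔ m ^ k))) hc0 ha hK fun k =>
        have := hfin' q.asIdeal (k + c)
        finrank_add_finrank_le_of_mul (hc k) (Ideal.mem_sup_left hx) (sup_le_sup_right hq.le _)
    refine ⟨b, hb, K + c, fun j => ?_⟩
    rw [RelSeries.head_cons, RelSeries.cons_length]
    exact hbj j

end growth

/-! ### Thickened rational points: local lower bound and global upper bound -/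

section rationalPoints

variable {F : Type*} [Field F] {n : ℕ}

theorem affineHilbert_succ_eq_finrank {R : Type*} [CommRing R] [Algebra F R]
    (φ : MvPolynomial (Fin n) F →ₐ[F] R) (t : ℕ) :
    affineHilbert φ (t + 1) =
      Module.finrank F ((restrictTotalDegree (Fin n) F t).map φ.toLinearMap) := by
  have h : (exponentsLT n (t + 1) : Set (Fin n →₀ ℕ)) = {b | (b.sum fun _ e => e) ≤ t} := by
    ext b
    simp only [Finset.mem_coe, mem_exponentsLT, Set.mem_ofPred_eq, Nat.lt_succ_iff]
    rfl
  rw [affineHilbert, span_map_monomial, h]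
  rfl

section translation

variable (P : Ideal (MvPolynomial (Fin n) F)) (x : Fin n → F)

/-- The presentation of the coordinate ring of an affine variety in the coordinates centred at a
rational point. -/
def centredPresentation : MvPolynomial (Fin n) F →ₐ[F] MvPolynomial (Fin n) F ⧸ P :=
  (Ideal.Quotient.mkₐ F P).comp (aeval fun i => X i - C (x i))

theorem centredPresentation_surjective : Function.Surjective (centredPresentation P x) := by
  refine (Ideal.Quotient.mkₐ_surjective F P).comp fun f => ⟨aeval (fun i => X i + C (x i)) f, ?_⟩
  have h : (aeval fun i => X i - C (x i)).comp (aeval fun i => X i + C (x i)) =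
      AlgHom.id F (MvPolynomial (Fin n) F) := by
    ext1 i
    simp
  exact AlgHom.congr_fun h f

/-- The ideal of a rational point in the coordinate ring of an affine variety. -/
def pointIdeal : Ideal (MvPolynomial (Fin n) F ⧸ P) :=
  (idealOfVars (Fin n) F).map (centredPresentation P x)

variable {P x}

/-- Evaluation of regular functions at a rational point. -/
def evalPoint (hx : x ∈ rationalPoints P) : MvPolynomial (Fin n) F ⧸ P →ₐ[F] F :=
  Ideal.Quotient.liftₐ P (aeval x) fun f hf => hx f hf

theorem evalPoint_surjective (hx : x ∈ rationalPoints P) :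
    Function.Surjective (evalPoint hx) :=
  fun c => ⟨algebraMap _ _ c, by simp⟩

theorem pointIdeal_eq_ker (hx : x ∈ rationalPoints P) :
    pointIdeal P x = RingHom.ker (evalPoint hx) := by
  have hcomp : (evalPoint hx).comp (centredPresentation P x) = aeval (0 : Fin n → F) := by
    ext i
    simp [evalPoint, centredPresentation]
  have hvars : idealOfVars (Fin n) F = RingHom.ker (aeval (0 : Fin n → F)) := by
    ext f
    rw [← pow_one (idealOfVars (Fin n) F), mem_pow_idealOfVars_iff', RingHom.mem_ker,
      aeval_zero]
    simp only [Nat.lt_one_iff, Finsupp.degree_eq_zero_iff, forall_eq]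
    simp [constantCoeff_eq]
  rw [pointIdeal]
  ext y
  rw [Ideal.mem_map_iff_of_surjective _ (centredPresentation_surjective P x), hvars]
  constructor
  · rintro ⟨f, hf, rfl⟩
    rw [RingHom.mem_ker] at hf ⊢
    rw [← AlgHom.comp_apply, hcomp, hf]
  · intro hy
    obtain ⟨f, rfl⟩ := centredPresentation_surjective P x y
    refine ⟨f, ?_, rfl⟩
    rw [RingHom.mem_ker] at hy ⊢
    rw [← hcomp, AlgHom.comp_apply, hy]

theorem pointIdeal_isMaximal (hx : x ∈ rationalPoints P) : (pointIdeal P x).IsMaximal := by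
  rw [pointIdeal_eq_ker hx]
  exact RingHom.ker_isMaximal_of_surjective (evalPoint hx).toRingHom (evalPoint_surjective hx)

theorem mk_mem_pointIdeal (hx : x ∈ rationalPoints P) {f : MvPolynomial (Fin n) F} :
    Ideal.Quotient.mk P f ∈ pointIdeal P x ↔ aeval x f = 0 := by
  rw [pointIdeal_eq_ker hx]
  rfl

/-- The chain gives growth of order `k ^ d` with an uncontrolled constant. A lower set growing this
fast contains a `d`-dimensional orthant, which replaces the constant by `1 / d!`. -/
theorem pow_le_factorial_mul_finrank_quotient_pointIdeal_pow [P.IsPrime] {d : ℕ}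
    (hx : x ∈ rationalPoints P)
    (hd : ∃ l : LTSeries (PrimeSpectrum (MvPolynomial (Fin n) F ⧸ P)), l.length = d ∧
      l.last = ⟨pointIdeal P x, (pointIdeal_isMaximal hx).isPrime⟩) {k : ℕ} (hk : 0 < k) :
    k ^ d ≤ d.factorial *
      Module.finrank F ((MvPolynomial (Fin n) F ⧸ P) ⧸ pointIdeal P x ^ k) := by
  obtain ⟨l, rfl, hlast⟩ := hd
  have hφ := centredPresentation_surjective P x
  have hfin : ∀ k, FiniteDimensional F ((MvPolynomial (Fin n) F ⧸ P) ⧸ pointIdeal P x ^ k) :=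
    finiteDimensional_quotient_pow hφ
  obtain ⟨a, ha, K, hK⟩ := exists_growth_of_ltSeries hfin l (by rw [hlast])
  have hcount : ∀ j : ℕ, a * (j : ℚ) ^ l.length ≤
      countLT (localStandardExponents (centredPresentation P x)) (j + K) := by
    intro j
    refine (hK j).trans
      (Nat.cast_le.2 (le_trans ?_ (finrank_quotient_pow_eq_countLT hφ (j + K)).le))
    change _ ≤ Module.finrank F ((MvPolynomial (Fin n) F ⧸ P) ⧸ pointIdeal P x ^ (j + K))
    have := hfin (j + K)
    exact LinearMap.finrank_le_finrank_of_surjective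
      (f := (Ideal.Quotient.factorₐ F (le_sup_right : pointIdeal P x ^ (j + K) ≤
        l.head.asIdeal ⊔ pointIdeal P x ^ (j + K))).toLinearMap)
      (Ideal.Quotient.factor_surjective le_sup_right)
  obtain ⟨A, hA, hAD⟩ := exists_finset_of_countLT_growth
    (isLowerSet_localStandardExponents _) ha hcount
  rw [pointIdeal, finrank_quotient_pow_eq_countLT hφ, ← hA]
  exact pow_le_factorial_mul_countLT A hAD hk

end translation

section frobenius

variable (F n) in
/-- The ideal generated by the equations `xᵢ ^ q = xᵢ`. -/
def fieldEquations (q : ℕ) : Ideal (MvPolynomial (Fin n) F) :=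
  Ideal.span (Set.range fun i : Fin n => X i ^ q - X i)

/-- Replacing `X i ^ q` by `X i` lowers the degree until all exponents are below `q`. -/
theorem top_le_restrictTotalDegree_sup_fieldEquations {q : ℕ} (hq : 2 ≤ q) :
    ⊤ ≤ restrictTotalDegree (Fin n) F (n * q) ⊔ (fieldEquations F n q).restrictScalars F := by
  have key : ∀ (N : ℕ) (a : Fin n →₀ ℕ), a.degree = N → monomial a (1 : F) ∈
      restrictTotalDegree (Fin n) F (n * q) ⊔ (fieldEquations F n q).restrictScalars F := by
    intro N
    induction N using Nat.strong_induction_on with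
    | _ N ih =>
      rintro a rfl
      by_cases ha : ∀ i, a i < q
      · refine Submodule.mem_sup_left ((mem_restrictTotalDegree _ _ _).2 ?_)
        refine (totalDegree_monomial_le _ _).trans ?_
        change a.degree ≤ _
        rw [Finsupp.degree_eq_sum]
        refine (Finset.sum_le_card_nsmul _ _ q fun i _ => (ha i).le).trans ?_
        simp
      · push Not at ha
        obtain ⟨i, hi⟩ := ha
        obtain ⟨b, rfl⟩ := exists_add_of_le (Finsupp.single_le_iff.2 hi)
        have hdec : monomial (Finsupp.single i q + b) (1 : F) =
            monomial (Finsupp.single i 1 + b) 1 + monomial b 1 * (X i ^ q - X i) := by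
          rw [mul_sub, X_pow_eq_monomial, X, monomial_mul, monomial_mul, one_mul,
            add_comm b, add_comm b]
          ring
        rw [hdec]
        refine Submodule.add_mem _ (ih _ ?_ _ rfl) (Submodule.mem_sup_right ?_)
        · simp only [map_add, Finsupp.degree_single]
          omega
        · exact Ideal.mul_mem_left _ _ (Ideal.subset_span ⟨i, rfl⟩)
  rintro f -
  induction f using MvPolynomial.induction_on' with
  | monomial a r =>
    have h : monomial a r = r • monomial a (1 : F) := by
      rw [smul_monomial, smul_eq_mul, mul_one]
    rw [h]
    exact Submodule.smul_mem _ _ (key _ a rfl)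
  | add p q hp hq => exact Submodule.add_mem _ hp hq

/-- Each factor `X i ^ q - X i` costs degree `q`; the cofactor, in the previous power, is reduced by
induction. -/
theorem fieldEquations_pow_le {q : ℕ} (hq : 2 ≤ q) (k : ℕ) :
    ((fieldEquations F n q) ^ k).restrictScalars F ≤
      restrictTotalDegree (Fin n) F (n * q + k * q) ⊔
        ((fieldEquations F n q) ^ (k + 1)).restrictScalars F := by
  induction k with
  | zero => simpa using top_le_iff.1 (top_le_restrictTotalDegree_sup_fieldEquations hq)
  | succ k ih =>
    intro f hf
    rw [Submodule.restrictScalars_mem, pow_succ'] at hf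
    have key : ∀ r ∈ fieldEquations F n q, ∀ s ∈ (fieldEquations F n q) ^ k, r * s ∈
        restrictTotalDegree (Fin n) F (n * q + (k + 1) * q) ⊔
          ((fieldEquations F n q) ^ (k + 1 + 1)).restrictScalars F := by
      intro r hr
      induction hr using Submodule.span_induction with
      | mem r hr =>
        obtain ⟨i, rfl⟩ := hr
        intro s hs
        obtain ⟨w, hw, z, hz, rfl⟩ := Submodule.mem_sup.1 (ih hs)
        rw [mul_add]
        refine Submodule.add_mem_sup ?_ ?_
        · rw [mem_restrictTotalDegree] at hw ⊢
          refine (totalDegree_mul _ _).trans ?_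
          have h1 : (X i ^ q - X i : MvPolynomial (Fin n) F).totalDegree ≤ q := by
            refine (totalDegree_sub _ _).trans (max_le ?_ ?_)
            · rw [totalDegree_X_pow]
            · rw [totalDegree_X]
              omega
          dsimp only
          rw [add_mul, one_mul]
          omega
        · rw [Submodule.restrictScalars_mem, pow_succ']
          exact Ideal.mul_mem_mul (Ideal.subset_span ⟨i, rfl⟩) hz
      | zero =>
        intro s _
        rw [zero_mul]
        exact Submodule.zero_mem _
      | add a b _ _ ha hb =>
        intro s hs
        rw [add_mul a b s]
        exact Submodule.add_mem _ (ha s hs) (hb s hs)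
      | smul c a _ ha =>
        intro s hs
        rw [smul_eq_mul, mul_comm c, mul_assoc]
        exact ha _ (Ideal.mul_mem_left _ _ hs)
    exact Submodule.mul_induction_on hf key fun _ _ h1 h2 => Submodule.add_mem _ h1 h2

theorem top_le_restrictTotalDegree_sup_fieldEquations_pow {q : ℕ} (hq : 2 ≤ q) (k : ℕ) :
    ⊤ ≤ restrictTotalDegree (Fin n) F (n * q + k * q) ⊔
      ((fieldEquations F n q) ^ k).restrictScalars F := by
  induction k with
  | zero => simp
  | succ k ih =>
    have hmono : restrictTotalDegree (Fin n) F (n * q + k * q) ≤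
        restrictTotalDegree (Fin n) F (n * q + (k + 1) * q) := by
      intro f hf
      rw [mem_restrictTotalDegree] at hf ⊢
      rw [add_mul]
      omega
    refine ih.trans (sup_le (hmono.trans le_sup_left) ?_)
    exact (fieldEquations_pow_le hq k).trans (sup_le_sup_right hmono _)

end frobenius

theorem sum_finrank_le_affineHilbert [Finite F] (P : Ideal (MvPolynomial (Fin n) F))
    [Fintype (rationalPoints P)] (k : ℕ) :
    ∑ x : rationalPoints P, Module.finrank F
      ((MvPolynomial (Fin n) F ⧸ P) ⧸ pointIdeal P (x : Fin n → F) ^ k) ≤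
    affineHilbert (Ideal.Quotient.mkₐ F P) (n * Nat.card F + k * Nat.card F + 1) := by
  classical
  have := Fintype.ofFinite F
  let I : rationalPoints P → Ideal (MvPolynomial (Fin n) F ⧸ P) := fun x => pointIdeal P x ^ k
  have hfin : ∀ x, FiniteDimensional F ((MvPolynomial (Fin n) F ⧸ P) ⧸ I x) := fun x =>
    finiteDimensional_quotient_pow (centredPresentation_surjective P x) k
  let ψ : (MvPolynomial (Fin n) F ⧸ P) →ₗ[F] ∀ x, (MvPolynomial (Fin n) F ⧸ P) ⧸ I x :=
    LinearMap.pi fun x => (Ideal.Quotient.mkₐ F (I x)).toLinearMap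
  -- Distinct points have distinct maximal ideals, so the Chinese remainder theorem makes `ψ`
  -- surjective.
  have hcop : Pairwise (Function.onFun IsCoprime I) := by
    intro x y hxy
    refine IsCoprime.pow ?_
    have hx := pointIdeal_isMaximal x.2
    have hy := pointIdeal_isMaximal y.2
    refine Ideal.isCoprime_iff_sup_eq.2 (hx.coprime_of_ne hy fun h => hxy ?_)
    refine Subtype.ext (funext fun i => ?_)
    have h1 : Ideal.Quotient.mk P (X i - C ((x : Fin n → F) i)) ∈ pointIdeal P x :=
      (mk_mem_pointIdeal x.2).2 (by simp)
    rw [h, mk_mem_pointIdeal y.2] at h1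
    have h2 : (y : Fin n → F) i - (x : Fin n → F) i = 0 := by simpa using h1
    exact (sub_eq_zero.1 h2).symm
  have hψ : Function.Surjective ψ := by
    intro z
    obtain ⟨w, hw⟩ := Ideal.quotientInfToPiQuotient_surj hcop z
    obtain ⟨r, rfl⟩ := Ideal.Quotient.mk_surjective w
    exact ⟨r, hw⟩
  have hq : 2 ≤ Nat.card F := Finite.one_lt_card
  -- The field equations vanish at every rational point, so their `k`-th power dies in each
  -- thickening.
  have hJ : ∀ f ∈ (fieldEquations F n (Nat.card F)) ^ k, ψ (Ideal.Quotient.mkₐ F P f) = 0 := by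
    intro f hf
    refine funext fun x => Ideal.Quotient.eq_zero_iff_mem.2 ?_
    have hle : (fieldEquations F n (Nat.card F)).map (Ideal.Quotient.mk P) ≤ pointIdeal P x := by
      rw [fieldEquations, Ideal.map_span, Ideal.span_le]
      rintro _ ⟨_, ⟨i, rfl⟩, rfl⟩
      refine (mk_mem_pointIdeal x.2).2 ?_
      simp [Nat.card_eq_fintype_card, FiniteField.pow_card]
    refine Ideal.pow_right_mono hle k ?_
    rw [← Ideal.map_pow]
    exact Ideal.mem_map_of_mem _ hf
  rw [affineHilbert_succ_eq_finrank]
  set W := (restrictTotalDegree (Fin n) F (n * Nat.card F + k * Nat.card F)).map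
    (Ideal.Quotient.mkₐ F P).toLinearMap
  have hW : FiniteDimensional F W := by
    refine Module.Finite.of_surjective
      ((Ideal.Quotient.mkₐ F P).toLinearMap.submoduleMap _)
      (LinearMap.submoduleMap_surjective _ _)
  have hfree : ∀ x, Module.Free F ((MvPolynomial (Fin n) F ⧸ P) ⧸ I x) := fun x =>
    Module.Free.of_divisionRing F _
  change ∑ x, Module.finrank F ((MvPolynomial (Fin n) F ⧸ P) ⧸ I x) ≤ _
  rw [← Module.finrank_pi_fintype F (M := fun x => (MvPolynomial (Fin n) F ⧸ P) ⧸ I x)]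
  refine LinearMap.finrank_le_finrank_of_surjective (f := ψ.domRestrict W) fun z => ?_
  obtain ⟨y, rfl⟩ := hψ z
  obtain ⟨f, rfl⟩ := Ideal.Quotient.mkₐ_surjective F P y
  obtain ⟨w, hw, g, hg, rfl⟩ := Submodule.mem_sup.1
    (top_le_restrictTotalDegree_sup_fieldEquations_pow (F := F) (n := n) hq k
      (Submodule.mem_top (x := f)))
  refine ⟨⟨Ideal.Quotient.mkₐ F P w, Submodule.mem_map_of_mem hw⟩, ?_⟩
  rw [map_add, map_add, hJ g hg]
  exact (add_zero (ψ (Ideal.Quotient.mkₐ F P w))).symm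

end rationalPoints

/-! ### The Hilbert polynomial of the projective closure -/

section projectiveClosure

variable {F : Type*} [Field F] {n : ℕ}

variable (F n) in
/-- Dehomogenization: the substitution of `1` for the homogenizing variable. -/
def dehomogenize : MvPolynomial (Fin (n + 1)) F →ₐ[F] MvPolynomial (Fin n) F :=
  aeval (Fin.cons 1 X)

theorem dehomogenize_monomial (a : Fin (n + 1) →₀ ℕ) (r : F) :
    dehomogenize F n (monomial a r) = monomial a.tail r := by
  rw [dehomogenize, aeval_monomial, monomial_eq, algebraMap_eq,
    Finsupp.prod_fintype _ _ fun i => pow_zero _, Finsupp.prod_fintype _ _ fun i => pow_zero _,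
    Fin.prod_univ_succ]
  simp [Finsupp.tail_apply]

theorem dehomogenize_homogenize (f : MvPolynomial (Fin n) F) :
    dehomogenize F n (homogenize f) = f := by
  rw [homogenize, map_sum]
  simp only [dehomogenize_monomial, Finsupp.tail_cons]
  exact f.as_sum.symm

variable (F n) in
/-- The homogenization of polynomials to a fixed degree `t`, as a linear map. -/
def homogenizeTo (t : ℕ) : MvPolynomial (Fin n) F →ₗ[F] MvPolynomial (Fin (n + 1)) F :=
  (basisMonomials (Fin n) F).constr F fun m => monomial (Finsupp.cons (t - m.degree) m) 1

theorem homogenizeTo_monomial (t : ℕ) (m : Fin n →₀ ℕ) (r : F) :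
    homogenizeTo F n t (monomial m r) = monomial (Finsupp.cons (t - m.degree) m) r := by
  have h : monomial m r = r • basisMonomials (Fin n) F m := by
    rw [coe_basisMonomials, smul_monomial, smul_eq_mul, mul_one]
  rw [h, map_smul, homogenizeTo, Module.Basis.constr_basis, smul_monomial, smul_eq_mul, mul_one]

theorem homogenizeTo_dehomogenize {t : ℕ} {g : MvPolynomial (Fin (n + 1)) F}
    (hg : g ∈ homogeneousSubmodule (Fin (n + 1)) F t) :
    homogenizeTo F n t (dehomogenize F n g) = g := by
  conv_lhs => rw [g.as_sum]
  conv_rhs => rw [g.as_sum]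
  rw [map_sum, map_sum]
  refine Finset.sum_congr rfl fun a ha => ?_
  rw [dehomogenize_monomial, homogenizeTo_monomial]
  have h1 : a.degree = t := by
    have := ((mem_homogeneousSubmodule _ _).1 hg) (mem_support_iff.1 ha)
    rwa [Finsupp.degree_eq_weight_one]
  have h2 := degree_cons (a 0) a.tail
  rw [Finsupp.cons_tail] at h2
  rw [show t - a.tail.degree = a 0 by omega, Finsupp.cons_tail]

theorem homogenizeTo_eq_mul {t : ℕ} {f : MvPolynomial (Fin n) F} (hf : f.totalDegree ≤ t) :
    homogenizeTo F n t f = X 0 ^ (t - f.totalDegree) * homogenize f := by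
  conv_lhs => rw [f.as_sum]
  rw [map_sum, homogenize, Finset.mul_sum]
  refine Finset.sum_congr rfl fun m hm => ?_
  have h1 : m.degree ≤ f.totalDegree := le_totalDegree hm
  rw [homogenizeTo_monomial, X_pow_eq_monomial, monomial_mul, one_mul]
  refine congrArg (fun a => monomial a (coeff m f)) (Finsupp.ext fun i => ?_)
  refine Fin.cases ?_ (fun i => ?_) i
  · simp
    omega
  · simp

theorem map_dehomogenize_homogeneousSubmodule (t : ℕ) :
    (homogeneousSubmodule (Fin (n + 1)) F t).map (dehomogenize F n).toLinearMap =
      restrictTotalDegree (Fin n) F t := by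
  refine le_antisymm ?_ ?_
  · rintro _ ⟨g, hg, rfl⟩
    rw [AlgHom.toLinearMap_apply, g.as_sum, map_sum]
    refine Submodule.sum_mem _ fun a ha => ?_
    rw [dehomogenize_monomial, mem_restrictTotalDegree]
    refine (totalDegree_monomial_le _ _).trans ?_
    have h1 : a.degree = t := by
      have := ((mem_homogeneousSubmodule _ _).1 hg) (mem_support_iff.1 ha)
      rwa [Finsupp.degree_eq_weight_one]
    have h2 := degree_cons (a 0) a.tail
    rw [Finsupp.cons_tail] at h2
    change a.tail.degree ≤ t
    omega
  · intro f hf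
    rw [mem_restrictTotalDegree] at hf
    rw [f.as_sum]
    refine Submodule.sum_mem _ fun m hm => ?_
    have h1 : m.degree ≤ t := (le_totalDegree hm).trans hf
    refine ⟨monomial (Finsupp.cons (t - m.degree) m) (coeff m f), ?_, ?_⟩
    · refine isHomogeneous_monomial _ ?_
      rw [degree_cons]
      omega
    · rw [AlgHom.toLinearMap_apply, dehomogenize_monomial, Finsupp.tail_cons]

/-- The Hilbert function of the projective closure is the affine Hilbert function. -/
theorem hilbertFunction_projectiveClosure (P : Ideal (MvPolynomial (Fin n) F)) (t : ℕ) :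
    hilbertFunction (projectiveClosure P) t =
      affineHilbert (Ideal.Quotient.mkₐ F P) (t + 1) := by
  rw [affineHilbert_succ_eq_finrank, hilbertFunction]
  set J := projectiveClosure P with hJ
  have hle : J ≤ P.comap (dehomogenize F n) := by
    rw [hJ, projectiveClosure, Ideal.span_le]
    rintro _ ⟨f, hf, rfl⟩
    change dehomogenize F n (homogenize f) ∈ P
    rwa [dehomogenize_homogenize]
  let Θ : (MvPolynomial (Fin (n + 1)) F ⧸ J) →ₐ[F] (MvPolynomial (Fin n) F ⧸ P) :=
    Ideal.quotientMapₐ P (dehomogenize F n) hle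
  set A := (homogeneousSubmodule (Fin (n + 1)) F t).map (Ideal.Quotient.mkₐ F J).toLinearMap
  have hB : (restrictTotalDegree (Fin n) F t).map (Ideal.Quotient.mkₐ F P).toLinearMap =
      LinearMap.range (Θ.toLinearMap.domRestrict A) := by
    rw [LinearMap.range_domRestrict, ← map_dehomogenize_homogeneousSubmodule,
      ← Submodule.map_comp, ← Submodule.map_comp]
    rfl
  rw [hB, LinearMap.finrank_range_of_inj]
  -- A form of degree `t` is a power of `X 0` times the homogenization of its dehomogenization; if
  -- the latter is in `P`, the form is in `J`.
  refine (injective_iff_map_eq_zero _).2 ?_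
  rintro ⟨_, g, hg, rfl⟩ hy
  have h1 : dehomogenize F n g ∈ P := Ideal.Quotient.eq_zero_iff_mem.1 hy
  refine Subtype.ext (Ideal.Quotient.eq_zero_iff_mem.2 ?_)
  have h2 : (dehomogenize F n g).totalDegree ≤ t := by
    rw [← mem_restrictTotalDegree, ← map_dehomogenize_homogeneousSubmodule]
    exact Submodule.mem_map_of_mem hg
  rw [← homogenizeTo_dehomogenize hg, homogenizeTo_eq_mul h2]
  exact Ideal.mul_mem_left _ _ (Ideal.subset_span ⟨_, h1, rfl⟩)

theorem isHilbertPolynomial_hilbertPolynomial (P : Ideal (MvPolynomial (Fin n) F)) :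
    IsHilbertPolynomial (projectiveClosure P) (hilbertPolynomial (projectiveClosure P)) := by
  have h : ∃ p, IsHilbertPolynomial (projectiveClosure P) p := by
    obtain ⟨p, hp⟩ := (eventuallyPolynomial_affineHilbert (Ideal.Quotient.mkₐ F P)).comp_add 1
    obtain ⟨t₀, ht₀⟩ := Filter.eventually_atTop.1 hp
    refine ⟨p, t₀, fun t ht => ?_⟩
    rw [hilbertFunction_projectiveClosure]
    exact ht₀ t ht
  rw [hilbertPolynomial, dif_pos h]
  exact h.choose_spec

section polynomial

theorem leadingCoeff_nonneg_of_eventually_nonneg {p : Polynomial ℚ}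
    (h : ∀ᶠ t : ℕ in Filter.atTop, 0 ≤ p.eval (t : ℚ)) : 0 ≤ p.leadingCoeff := by
  by_contra! hneg
  have hp : p ≠ 0 := by
    rintro rfl
    simp at hneg
  rcases Nat.eq_zero_or_pos p.natDegree with h0 | hpos
  · obtain ⟨t, ht⟩ := h.exists
    rw [Polynomial.eq_C_of_natDegree_eq_zero h0, Polynomial.eval_C] at ht
    rw [Polynomial.leadingCoeff, h0] at hneg
    exact absurd ht (not_le.2 hneg)
  · have ht := (p.tendsto_atBot_of_leadingCoeff_nonpos
      (Polynomial.natDegree_pos_iff_degree_pos.1 hpos) hneg.le).comp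
        tendsto_natCast_atTop_atTop
    obtain ⟨t, h1, h2⟩ := (h.and (ht.eventually_lt_atBot 0)).exists
    exact absurd h1 (not_le.2 h2)

theorem eventually_nonneg_of_leadingCoeff_nonneg {p : Polynomial ℚ} (hp : 0 ≤ p.leadingCoeff) :
    ∀ᶠ t : ℕ in Filter.atTop, 0 ≤ p.eval (t : ℚ) := by
  rcases Nat.eq_zero_or_pos p.natDegree with h0 | hpos
  · rw [Polynomial.leadingCoeff, h0] at hp
    rw [Polynomial.eq_C_of_natDegree_eq_zero h0]
    exact Filter.Eventually.of_forall fun t => by simpa using hp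
  · exact ((p.tendsto_atTop_of_leadingCoeff_nonneg (Polynomial.natDegree_pos_iff_degree_pos.1 hpos) hp).comp
      tendsto_natCast_atTop_atTop).eventually_ge_atTop 0

theorem coeff_nonneg_of_eventually_nonneg {p : Polynomial ℚ} {d : ℕ} (hd : p.natDegree ≤ d)
    (h : ∀ᶠ t : ℕ in Filter.atTop, 0 ≤ p.eval (t : ℚ)) : 0 ≤ p.coeff d := by
  rcases hd.eq_or_lt with rfl | hlt
  · exact leadingCoeff_nonneg_of_eventually_nonneg h
  · rw [Polynomial.coeff_eq_zero_of_natDegree_lt hlt]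

/-- As a polynomial in `k`, the right side has `p.coeff d * q ^ d` as its coefficient of `k ^ d`,
even when `p` has degree below `d`. -/
theorem le_coeff_mul_pow_of_eventually_le {p : Polynomial ℚ} {d : ℕ} (hd : p.natDegree ≤ d) {c b q : ℚ}
    (h : ∀ᶠ k : ℕ in Filter.atTop, c * (k : ℚ) ^ d ≤ p.eval (b + k * q)) :
    c ≤ p.coeff d * q ^ d := by
  set r := p.comp (Polynomial.C q * Polynomial.X + Polynomial.C b) - Polynomial.C c * Polynomial.X ^ d with hr
  have hdeg : (p.comp (Polynomial.C q * Polynomial.X + Polynomial.C b)).natDegree ≤ d := by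
    refine Polynomial.natDegree_comp_le.trans ?_
    calc p.natDegree * (Polynomial.C q * Polynomial.X + Polynomial.C b).natDegree ≤ d * 1 :=
          Nat.mul_le_mul hd Polynomial.natDegree_linear_le
      _ = d := mul_one d
  have h1 : 0 ≤ r.coeff d := by
    refine coeff_nonneg_of_eventually_nonneg ?_ ?_
    · exact (Polynomial.natDegree_sub_le _ _).trans (max_le hdeg (Polynomial.natDegree_C_mul_X_pow_le _ _))
    · filter_upwards [h] with k hk
      simp only [hr, Polynomial.eval_sub, Polynomial.eval_comp, Polynomial.eval_add, Polynomial.eval_mul, Polynomial.eval_C, Polynomial.eval_X, Polynomial.eval_pow]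
      rw [mul_comm q, add_comm _ b]
      linarith
  have h2 : (p.comp (Polynomial.C q * Polynomial.X + Polynomial.C b)).coeff d = p.coeff d * q ^ d := by
    have h3 : ∀ m, m ≤ d → (((Polynomial.C q * Polynomial.X + Polynomial.C b : Polynomial ℚ) ^ m).coeff d) = if m = d then q ^ d else 0 := by
      intro m hm
      split_ifs with hmd
      · subst hmd
        have := Polynomial.coeff_pow_of_natDegree_le (p := Polynomial.C q * Polynomial.X + Polynomial.C b) (n := 1) (m := m)
          Polynomial.natDegree_linear_le
        rw [mul_one] at this
        rw [this]
        simp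
      · refine Polynomial.coeff_eq_zero_of_natDegree_lt (Polynomial.natDegree_pow_le.trans_lt ?_)
        calc m * (Polynomial.C q * Polynomial.X + Polynomial.C b : Polynomial ℚ).natDegree ≤ m * 1 :=
              Nat.mul_le_mul_left _ Polynomial.natDegree_linear_le
          _ < d := by omega
    rw [Polynomial.comp, Polynomial.eval₂_eq_sum_range' Polynomial.C (Nat.lt_succ_of_le hd), Polynomial.finsetSum_coeff]
    simp only [Polynomial.coeff_C_mul]
    rw [Finset.sum_eq_single_of_mem d (Finset.self_mem_range_succ d), h3 d le_rfl, if_pos rfl]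
    intro m hm hmd
    rw [h3 m (Nat.lt_succ_iff.1 (Finset.mem_range.1 hm)), if_neg hmd, mul_zero]
  rw [hr, Polynomial.coeff_sub, h2, Polynomial.coeff_C_mul, Polynomial.coeff_X_pow, if_pos rfl, mul_one] at h1
  linarith

theorem exists_growth_of_eventually_eq_eval {p : Polynomial ℚ} (hp : 0 < p.leadingCoeff) {f : ℕ → ℚ}
    (h : ∀ᶠ t : ℕ in Filter.atTop, f t = p.eval (t : ℚ)) :
    ∃ a : ℚ, 0 < a ∧ ∃ K : ℕ, ∀ j : ℕ, a * (j : ℚ) ^ p.natDegree ≤ f (j + K) := by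
  have hp0 : p ≠ 0 := Polynomial.leadingCoeff_ne_zero.1 hp.ne'
  -- Half of the leading term is kept; the other half absorbs the lower terms.
  set r := p - Polynomial.C (p.leadingCoeff / 2) * Polynomial.X ^ p.natDegree with hr
  have hrd : r.natDegree ≤ p.natDegree :=
    (Polynomial.natDegree_sub_le _ _).trans (max_le le_rfl (Polynomial.natDegree_C_mul_X_pow_le _ _))
  have hrc : r.coeff p.natDegree = p.leadingCoeff / 2 := by
    rw [hr, Polynomial.coeff_sub, Polynomial.coeff_C_mul, Polynomial.coeff_X_pow, if_pos rfl, mul_one, Polynomial.coeff_natDegree]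
    ring
  have hev : ∀ᶠ t : ℕ in Filter.atTop, 0 ≤ r.eval (t : ℚ) := by
    refine eventually_nonneg_of_leadingCoeff_nonneg ?_
    rw [Polynomial.leadingCoeff, Polynomial.natDegree_eq_of_le_of_coeff_ne_zero hrd (by rw [hrc]; positivity), hrc]
    positivity
  obtain ⟨K, hK⟩ := Filter.eventually_atTop.1 (h.and hev)
  refine ⟨p.leadingCoeff / 2, by positivity, K, fun j => ?_⟩
  obtain ⟨h1, h2⟩ := hK (j + K) (by omega)
  rw [h1]
  simp only [hr, Polynomial.eval_sub, Polynomial.eval_mul, Polynomial.eval_C, Polynomial.eval_pow, Polynomial.eval_X, sub_nonneg] at h2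
  refine le_trans ?_ h2
  refine mul_le_mul_of_nonneg_left ?_ (by positivity)
  refine pow_le_pow_left₀ (by positivity) ?_ _
  push_cast
  linarith [(Nat.cast_nonneg K : (0 : ℚ) ≤ K)]

end polynomial

end projectiveClosure

/-! ### The bound for one component, and the covering by components -/

section components

variable {F : Type*} [Field F] {n : ℕ}

/-- Growth of order `p.natDegree` forces that many variables to be standard, hence algebraically
independent in the coordinate ring. -/
theorem natDegree_hilbertPolynomial_le (P : Ideal (MvPolynomial (Fin n) F)) {d : ℕ}
    (hd : ∀ {A : Finset (Fin n)} {x : A → MvPolynomial (Fin n) F ⧸ P},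
      AlgebraicIndependent F x → A.card ≤ d) :
    (hilbertPolynomial (projectiveClosure P)).natDegree ≤ d := by
  obtain ⟨t₀, ht₀⟩ := isHilbertPolynomial_hilbertPolynomial P
  set p := hilbertPolynomial (projectiveClosure P)
  have hev : ∀ᶠ t : ℕ in Filter.atTop, (countLT
      (standardExponents (Ideal.Quotient.mkₐ F P)) (t + 1) : ℚ) = p.eval (t : ℚ) := by
    filter_upwards [Filter.eventually_ge_atTop t₀] with t ht
    rw [← ht₀ t ht, hilbertFunction_projectiveClosure, affineHilbert_eq_countLT]
  have hnonneg : 0 ≤ p.leadingCoeff := by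
    refine leadingCoeff_nonneg_of_eventually_nonneg ?_
    filter_upwards [hev] with t ht
    rw [← ht]
    exact Nat.cast_nonneg _
  rcases hnonneg.eq_or_lt with h0 | hpos
  · rw [Polynomial.leadingCoeff_eq_zero.1 h0.symm, Polynomial.natDegree_zero]
    exact Nat.zero_le _
  · obtain ⟨a, ha, K, hK⟩ := exists_growth_of_eventually_eq_eval hpos hev
    obtain ⟨A, hA, hAD⟩ := exists_finset_of_countLT_growth
      (isLowerSet_standardExponents (Ideal.Quotient.mkₐ F P)) ha (K := K + 1) hK
    rw [← hA]
    exact hd (algebraicIndependent_of_standardExponents hAD)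

theorem ncard_rationalPoints_le_of_isPrime [Finite F] (P : Ideal (MvPolynomial (Fin n) F))
    [P.IsPrime] :
    ((rationalPoints P).ncard : ℚ) ≤ degree P * (Nat.card F : ℚ) ^ dim P := by
  obtain ⟨s, hdim, hind, hchain⟩ := exists_dimension_of_finiteType F (MvPolynomial (Fin n) F ⧸ P)
  obtain ⟨t₀, ht₀⟩ := isHilbertPolynomial_hilbertPolynomial P
  set p := hilbertPolynomial (projectiveClosure P) with hp
  have hpdeg : p.natDegree ≤ s := natDegree_hilbertPolynomial_le P hind
  have hlc : 0 ≤ p.leadingCoeff := by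
    refine leadingCoeff_nonneg_of_eventually_nonneg ?_
    filter_upwards [Filter.eventually_ge_atTop t₀] with t ht
    rw [← ht₀ t ht]
    exact Nat.cast_nonneg _
  have hs : dim P = s := by
    refine le_antisymm (by exact_mod_cast (coe_dim P).trans_le hdim) ?_
    obtain ⟨M, hM⟩ := Ideal.exists_maximal (MvPolynomial (Fin n) F ⧸ P)
    obtain ⟨l, hl, -⟩ := hchain M hM
    have h1 : ((l.length : ℕ) : WithBot ℕ∞) ≤ dim P := by
      rw [coe_dim P]
      exact Order.LTSeries.length_le_krullDim l
    rw [← hl]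
    exact_mod_cast h1
  have hfin : (rationalPoints P).Finite := Set.toFinite _
  have := hfin.fintype
  have hq : 0 < Nat.card F := Nat.card_pos
  -- The two bounds on the thickened points, compared in the coefficient of `k ^ s`.
  have key : ((rationalPoints P).ncard : ℚ) / s.factorial ≤
      p.coeff s * (Nat.card F : ℚ) ^ s := by
    refine le_coeff_mul_pow_of_eventually_le hpdeg (b := n * Nat.card F) ?_
    filter_upwards [Filter.eventually_ge_atTop (t₀ + 1)] with k hk
    have hlarge : t₀ ≤ n * Nat.card F + k * Nat.card F := by nlinarith
    have h1 := sum_finrank_le_affineHilbert P k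
    have h2 : ∀ x : rationalPoints P, k ^ s ≤ s.factorial * Module.finrank F
        ((MvPolynomial (Fin n) F ⧸ P) ⧸ pointIdeal P (x : Fin n → F) ^ k) := fun x =>
      pow_le_factorial_mul_finrank_quotient_pointIdeal_pow x.2 (hchain _ (pointIdeal_isMaximal x.2)) (by omega)
    have h3 : (rationalPoints P).ncard * k ^ s ≤ s.factorial *
        affineHilbert (Ideal.Quotient.mkₐ F P) (n * Nat.card F + k * Nat.card F + 1) := by
      refine le_trans ?_ (Nat.mul_le_mul_left _ h1)
      rw [Finset.mul_sum, Set.ncard_eq_toFinset_card', Set.toFinset_card, ← Finset.card_univ,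
        ← smul_eq_mul]
      exact Finset.card_nsmul_le_sum _ _ _ fun x _ => h2 x
    rw [← hilbertFunction_projectiveClosure] at h3
    have h4 := ht₀ _ hlarge
    push_cast at h4
    rw [← h4, div_mul_eq_mul_div, div_le_iff₀ (by positivity), mul_comm (hilbertFunction _ _ : ℚ)]
    exact_mod_cast h3
  -- Only `p.natDegree ≤ s` is known; were it strict, the coefficient would be `0`, and the
  -- inequality still holds.
  have hcoeff : p.coeff s ≤ p.leadingCoeff := by
    rcases hpdeg.eq_or_lt with h | h
    · rw [← h, Polynomial.coeff_natDegree]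
    · rw [Polynomial.coeff_eq_zero_of_natDegree_lt h]
      exact hlc
  rw [degree, ← hp, hs]
  rw [div_le_iff₀ (by positivity)] at key
  calc ((rationalPoints P).ncard : ℚ) ≤ p.coeff s * (Nat.card F : ℚ) ^ s * s.factorial := key
    _ ≤ p.leadingCoeff * (Nat.card F : ℚ) ^ s * s.factorial := by gcongr
    _ = _ := by ring

/-- The kernel of evaluation at a point is a prime containing `I`, so it contains a minimal prime
over `I`. -/
theorem rationalPoints_subset_iUnion_components (I : Ideal (MvPolynomial (Fin n) F)) :
    rationalPoints I ⊆ ⋃ P ∈ components I, rationalPoints P := by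
  intro x hx
  have hle : I ≤ RingHom.ker (aeval x : MvPolynomial (Fin n) F →ₐ[F] F) := fun f hf => hx f hf
  have hprime : (RingHom.ker (aeval x : MvPolynomial (Fin n) F →ₐ[F] F)).IsPrime :=
    RingHom.ker_isPrime _
  obtain ⟨P, hP, hPx⟩ := Ideal.exists_minimalPrimes_le hle
  refine Set.mem_iUnion₂.2 ⟨P, ?_, fun f hf => hPx hf⟩
  rwa [components, Set.Finite.mem_toFinset]

end components

end AffinePoints

end

theorem theorem2p1 {F : Type*} [Field F] [Finite F] {n : ℕ}
    (I : Ideal (MvPolynomial (Fin n) F)) (hI : I.IsRadical) :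
    ((AffinePoints.rationalPoints I).ncard : ℚ) ≤
      ∑ P ∈ AffinePoints.components I,
        AffinePoints.degree P * (Nat.card F : ℚ) ^ AffinePoints.dim P := by
  have h1 : (AffinePoints.rationalPoints I).ncard ≤
      ∑ P ∈ AffinePoints.components I, (AffinePoints.rationalPoints P).ncard :=
    (Set.ncard_le_ncard (AffinePoints.rationalPoints_subset_iUnion_components I)
      (Set.toFinite _)).trans (Finset.set_ncard_biUnion_le _ _)
  refine (Nat.cast_le.2 h1).trans ?_
  rw [Nat.cast_sum]
  refine Finset.sum_le_sum fun P hP => ?_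
  rw [AffinePoints.components, Set.Finite.mem_toFinset] at hP
  have : P.IsPrime := hP.1.1
  exact AffinePoints.ncard_rationalPoints_le_of_isPrime P
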